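/- Let $A,B\ge 1$ and $p\in(0,2]$. Consider a zero-sum matrix game in which the min-player has $A$ actions, the max-player has $B$ actions, and the loss of the action pair $(a,b)$ is random with a distribution on $[0,1]$ that depends only on $(a,b)$ and has mean $L(a,b)$. For mixed policies put $L(\mu,\nu)=\sum_{a,b}\mu(a)\nu(b)L(a,b)$ and $EG(\mu,\nu)=\max_{\nu'}L(\mu,\nu')-\min_{\mu'}L(\mu',\nu)$, the exploitability gap. In each round $t=1,2,\dots$, given the past $\mathcal F^{t-1}=\sigma(u,a^1,b^1,\ell^1,\dots,a^{t-1},b^{t-1},\ell^{t-1})$, the players draw independently $a^t\sim\mu^t$ and $b^t\sim\nu^t$; given the past and these two actions, a loss $\ell^t$ is drawn from the distribution attached to $(a^t,b^t)$. The min-player observes $a^t$ and its loss $\ell^t$, the max-player $b^t$ and its loss $1-\ell^t$. Here $u$ is a seed, uniform on $[0,1]$, shared by the two players. EXP3-IX, for a player with $K$ actions, plays in its $k$-th round the policy $\pi^k(i)\propto\exp\bigl(-\eta^k\sum_{s<k}\hat\ell^s(i)\bigr)$, where $\hat\ell^s(i)=\dfrac{x^s}{\pi^s(i)+\gamma^s}$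 if $i$ is the action played in its $s$-th round and $x^s$ the loss observed there, and $\hat\ell^s(i)=0$ for the other actions, with $\eta^k=2\gamma^k=\sqrt{\log K/(Kk)}$. Its output after $k$ rounds is $\hat\pi^k=\frac1k\sum_{s=1}^k\pi^s$. In the explore-or-exploit scheme with exploration probabilities $p^t=t^{-p/(2+p)}$, each player runs EXP3-IX (with $K=A$ for the min-player and $K=B$ for the max-player). Let $k^0=0$ and $k^t=\lfloor\sum_{i=1}^t p^i+u\rfloor$. In round $t$, if $k^t>k^{t-1}$, both players play the current policy of their EXP3-IX and update it with their own action and loss; otherwise both play its current output, without updating. Then the profiles $(\mu^t,\nu^t)_{t\ge1}$ played are predictable with respect to $(\mathcal F^t)$ and satisfy $L^p$ last-iterate convergence with rate $$f^t=17\sqrt{A+B}\,2^{1/p}\,t^{-1/(2+p)}\log\bigl(4(A+B)t^2/p\bigr),$$ that is, $f$ is positive, eventually decreasing and tends to $0$, and for all $t\ge1$ $$\mathbb E\bigl[EG(\mu^t,\nu^t)^p\bigr]^{1/p}\le f^t.$$ -/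

import Mathlib

open MeasureTheory ProbabilityTheory Filter

noncomputable section

namespace BanditGame

/-! ### Zero-sum matrix games -/

/-- A zero-sum matrix game with `A × B` actions and random losses: when the actions `(a, b)` are
played, the loss is drawn from the probability distribution `lossLaw a b` on `[0,1]`. The min-player
chooses `a` and the max-player chooses `b`. -/
structure MatrixGame (A B : ℕ) where
  lossLaw : Fin A → Fin B → Measure ℝ
  isProb : ∀ a b, IsProbabilityMeasure (lossLaw a b)
  support : ∀ a b, lossLaw a b (Set.Icc 0 1)ᶜ = 0

namespace MatrixGame

variable {A B : ℕ}

/-- The mean loss `L(a,b)`. -/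
def meanLoss (G : MatrixGame A B) (a : Fin A) (b : Fin B) : ℝ :=
  ∫ x, x ∂(G.lossLaw a b)

/-- The expected loss `L(μ,ν)`, where `a ∼ μ` and `b ∼ ν` independently. -/
def expLoss (G : MatrixGame A B) (μ : Fin A → ℝ) (ν : Fin B → ℝ) : ℝ :=
  ∑ a, ∑ b, μ a * ν b * G.meanLoss a b

/-- The exploitability gap `max_{ν'} L(μ,ν') - min_{μ'} L(μ',ν)`. -/
def exploitabilityGap (G : MatrixGame A B) (μ : Fin A → ℝ) (ν : Fin B → ℝ) : ℝ :=
  sSup ((fun ν' => G.expLoss μ ν') '' stdSimplex ℝ (Fin B))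
    - sInf ((fun μ' => G.expLoss μ' ν) '' stdSimplex ℝ (Fin A))

end MatrixGame

/-! ### Sequential learning with bandit feedback (rounds are numbered `1, 2, 3, …`) -/

section Play

variable {A B : ℕ} {Ω W : Type*} [MeasurableSpace Ω] [MeasurableSpace W]

/-- The `σ`-algebra `𝓕ᵗ = σ(u, a¹, b¹, ℓ¹, …, aᵗ, bᵗ, ℓᵗ)` generated by the internal randomness `u`
of the players and the observations of the first `t` rounds. -/
@[reducible] def history (u : Ω → W) (a : ℕ → Ω → Fin A) (b : ℕ → Ω → Fin B) (loss : ℕ → Ω → ℝ) (t : ℕ) :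
    MeasurableSpace Ω :=
  MeasurableSpace.comap u inferInstance ⊔
    ⨆ s ∈ Finset.Icc 1 t, (MeasurableSpace.comap (a s) inferInstance ⊔
      MeasurableSpace.comap (b s) inferInstance ⊔ MeasurableSpace.comap (loss s) inferInstance)

/-- `IsPlay G P u a b loss μ ν`: the game `G` is played repeatedly, the players having internal
randomness `u`. In round `t + 1`, conditionally on `𝓕ᵗ`, the actions are drawn independently from
the policies `μ (t + 1)` and `ν (t + 1)`, and conditionally on `𝓕ᵗ` and these two actions, the
loss is drawn from the law that the game attaches to them. -/
structure IsPlay (G : MatrixGame A B) (P : Measure Ω) (u : Ω → W)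
    (a : ℕ → Ω → Fin A) (b : ℕ → Ω → Fin B) (loss : ℕ → Ω → ℝ)
    (μ : ℕ → Ω → Fin A → ℝ) (ν : ℕ → Ω → Fin B → ℝ) : Prop where
  measurable_seed : Measurable u
  measurable_min : ∀ t, Measurable (a t)
  measurable_max : ∀ t, Measurable (b t)
  measurable_loss : ∀ t, Measurable (loss t)
  action_law : ∀ (t : ℕ) (i : Fin A) (j : Fin B),
    P⟦{w | a (t + 1) w = i ∧ b (t + 1) w = j} | history u a b loss t⟧
      =ᵐ[P] fun w => μ (t + 1) w i * ν (t + 1) w j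
  loss_law : ∀ (t : ℕ) (S : Set ℝ), MeasurableSet S →
    P⟦loss (t + 1) ⁻¹' S | history u a b loss t ⊔
        (MeasurableSpace.comap (a (t + 1)) inferInstance ⊔
          MeasurableSpace.comap (b (t + 1)) inferInstance)⟧
      =ᵐ[P] fun w => (G.lossLaw (a (t + 1) w) (b (t + 1) w)).real S

/-- A learning sequence: a sequence of profiles of mixed policies that is predictable with respect
to the filtration of the observations. -/
def IsLearningSequence (u : Ω → W) (a : ℕ → Ω → Fin A) (b : ℕ → Ω → Fin B) (loss : ℕ → Ω → ℝ)
    (μ : ℕ → Ω → Fin A → ℝ) (ν : ℕ → Ω → Fin B → ℝ) : Prop :=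
  ∀ t : ℕ,
    (∀ w, μ (t + 1) w ∈ stdSimplex ℝ (Fin A)) ∧ (∀ w, ν (t + 1) w ∈ stdSimplex ℝ (Fin B)) ∧
    Measurable[history u a b loss t] (μ (t + 1)) ∧ Measurable[history u a b loss t] (ν (t + 1))

/-- `Lᵖ` last-iterate convergence with rate `f`: the profiles form a learning sequence, the rate `f`
is positive, eventually decreasing, and tends to `0`, and `‖EG(μᵗ,νᵗ)‖_p ≤ fᵗ` in every round
`t ≥ 1`, where `‖X‖_p = 𝔼[|X|ᵖ]^(1/p)` (for any `0 < p`, also `p < 1`). -/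
structure LastIterateConvergence (G : MatrixGame A B) (P : Measure Ω) (u : Ω → W)
    (a : ℕ → Ω → Fin A) (b : ℕ → Ω → Fin B) (loss : ℕ → Ω → ℝ)
    (μ : ℕ → Ω → Fin A → ℝ) (ν : ℕ → Ω → Fin B → ℝ) (p : ℝ) (f : ℕ → ℝ) : Prop where
  learning : IsLearningSequence u a b loss μ ν
  rate_pos : ∀ t, 1 ≤ t → 0 < f t
  rate_antitone : ∃ t₀, AntitoneOn f (Set.Ici t₀)
  rate_tendsto : Tendsto f atTop (nhds 0)
  bound : ∀ t, 1 ≤ t →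
    eLpNorm (fun w => G.exploitabilityGap (μ t w) (ν t w)) (ENNReal.ofReal p) P
      ≤ ENNReal.ofReal (f t)

end Play

/-! ### Algorithms -/

/-- An algorithm for one player with actions `ι` and bandit feedback. In state `s` it plays the
policy `policy s`; `output s` is the policy that it would currently return; after playing the action
`i` and observing the loss `x` its new state is `update s i x`. -/
structure Learner (ι : Type) where
  State : Type
  init : State
  policy : State → ι → ℝ
  output : State → ι → ℝ
  update : State → ι → ℝ → State

/-- The state of EXP3-IX: the number of completed rounds, the cumulative loss estimates, and the sum
of the policies played so far. -/
structure Exp3IXState (ι : Type) where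
  round : ℕ
  estLoss : ι → ℝ
  policySum : ι → ℝ

/-- The policy of EXP3-IX in round `t`, where `t - 1` rounds are completed: exponential weights
`exp(-ηᵗ · ∑_{s<t} ℓ̂ˢ(i))`, normalized. -/
def Exp3IXState.policy {ι : Type} [Fintype ι] (η : ℕ → ℝ) (s : Exp3IXState ι) (i : ι) : ℝ :=
  Real.exp (-(η (s.round + 1) * s.estLoss i)) /
    ∑ j, Real.exp (-(η (s.round + 1) * s.estLoss j))

/-- EXP3-IX with learning rates `ηᵗ` and implicit exploration parameters `γᵗ`. The loss estimates
are `ℓ̂ᵗ(i) = ℓᵗ / (μᵗ(i) + γᵗ)` for the action `i` played in round `t`, and `0` for the other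
actions; the output is the average of the policies played so far. -/
def exp3IX {ι : Type} [Fintype ι] [DecidableEq ι] (η γ : ℕ → ℝ) : Learner ι where
  State := Exp3IXState ι
  init := ⟨0, fun _ => 0, fun _ => 0⟩
  policy s := s.policy η
  output s := fun i => s.policySum i / s.round
  update s i x :=
    { round := s.round + 1
      estLoss := fun j =>
        s.estLoss j + if j = i then x / (s.policy η j + γ (s.round + 1)) else 0
      policySum := fun j => s.policySum j + s.policy η j }

/-- The anytime step size `√(log K / (K t))` for `K` actions. -/
def anytimeStep (K t : ℕ) : ℝ := Real.sqrt (Real.log K / (K * t))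

/-- EXP3-IX for `K` actions with `ηᵗ = 2 γᵗ = √(log K / (K t))`. -/
def anytimeExp3IX (K : ℕ) : Learner (Fin K) :=
  exp3IX (anytimeStep K) (fun t => anytimeStep K t / 2)

/-- The counter `kᵗ` of the explore-or-exploit scheme: `k⁰ = 0` and `kᵗ = ⌊p¹ + ⋯ + pᵗ + u⌋`. -/
def exploreCount (q : ℕ → ℝ) (u : ℝ) : ℕ → ℕ
  | 0 => 0
  | t + 1 => ⌊(∑ i ∈ Finset.Icc 1 (t + 1), q i) + u⌋₊

/-- The state of the base algorithm of one player after `t` rounds of the explore-or-exploit scheme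
with exploration probabilities `q` and seed `u`: it is updated in the rounds where the counter
increases, with the player's own action and loss. -/
def eoeState {ι : Type} (𝒜 : Learner ι) (q : ℕ → ℝ) (u : ℝ) (act : ℕ → ι) (loss : ℕ → ℝ) :
    ℕ → 𝒜.State
  | 0 => 𝒜.init
  | t + 1 =>
    if exploreCount q u t < exploreCount q u (t + 1) then
      𝒜.update (eoeState 𝒜 q u act loss t) (act (t + 1)) (loss (t + 1))
    else eoeState 𝒜 q u act loss t

/-- The policy played by one player in round `t ≥ 1` of the explore-or-exploit scheme: the current
policy of the base algorithm if the counter increases (explore), and its current output otherwise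
(exploit). It depends only on the seed and on the player's own actions and losses in the rounds
before `t`. -/
def eoePolicy {ι : Type} (𝒜 : Learner ι) (q : ℕ → ℝ) (u : ℝ) (act : ℕ → ι) (loss : ℕ → ℝ)
    (t : ℕ) : ι → ℝ :=
  if exploreCount q u (t - 1) < exploreCount q u t then
    𝒜.policy (eoeState 𝒜 q u act loss (t - 1))
  else 𝒜.output (eoeState 𝒜 q u act loss (t - 1))

section Profile

variable {A B : ℕ} {Ω : Type*}

/-- The min-player's policies in the explore-or-exploit scheme; this player's loss is `ℓ`. -/
def eoeMin (𝒜 : Learner (Fin A)) (q : ℕ → ℝ) (u : Ω → unitInterval) (a : ℕ → Ω → Fin A)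
    (loss : ℕ → Ω → ℝ) (t : ℕ) (w : Ω) : Fin A → ℝ :=
  eoePolicy 𝒜 q (u w) (fun s => a s w) (fun s => loss s w) t

/-- The max-player's policies in the explore-or-exploit scheme; this player's loss is `1 - ℓ`. -/
def eoeMax (𝒜 : Learner (Fin B)) (q : ℕ → ℝ) (u : Ω → unitInterval) (b : ℕ → Ω → Fin B)
    (loss : ℕ → Ω → ℝ) (t : ℕ) (w : Ω) : Fin B → ℝ :=
  eoePolicy 𝒜 q (u w) (fun s => b s w) (fun s => 1 - loss s w) t

end Profile

/-- The exploration probabilities `pᵗ = t^(-p/(2+p))`. -/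
def exploreProb (p : ℝ) (t : ℕ) : ℝ := (t : ℝ) ^ (-(p / (2 + p)))

end BanditGame

end

open BanditGame

namespace BanditGame

/-! ### Elementary inequalities -/

/-! An exploring round has probability at most p^t, and the gap never exceeds 1, so exploration adds
at most p^t to the p-th moment of the gap. In an exploiting round both players use the averages of
their policies over the same N exploring rounds. The two losses observed in a round sum to 1, so
they cancel when the regrets of the players are added, and the gap of the averages is at most the
sum of the regrets divided by N (`exploitabilityGap_le_regret`). Regret here compares the losses
actually observed with the conditional mean losses of a fixed action.

Regret has a pathwise half and a probabilistic half. The exponential-weights potential bounds the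
observed losses by log K / η, plus the estimated loss of the comparator, plus the sum of η times the
estimates of the played actions (`sum_loss_le`). Implicit exploration makes each weighted estimate
at most log(1 + αx/π). The product of the factors 1 + αx/π, compensated by the exponential of minus
the conditional means, is a supermartingale (`BanditFeedback.lintegral_expProduct_le`), so Markov's
inequality lets conditional means replace estimates. The count N and the step sizes are functions of
the seed, hence known at time 0 and admissible as weights. The outcome is regret at most √N · L ·
(4.21 √K + 1) off an event of probability at most (K + 1) exp(-L)
(`BanditFeedback.exists_regret_control`).

For every seed √N is at least t^(1/(2+p)) / 2 when t ≥ 2 and N counts the rounds before t. With L =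
log(4(A+B)t²/p) the bad event has probability at most p · p^t, and off it the gap in an exploiting
round is at most D t^(-1/(2+p)) with D = 17 √(A+B) L; the p-th power of this is D^p p^t. All three
contributions are thus multiples of p^t, which is the balance behind the exponent -p/(2+p), and 1 +
p + D^p ≤ 2 D^p produces the factor 2^(1/p) (`eLpNorm_gap_le`). -/

theorem exp_neg_le_quadratic {z : ℝ} (hz : 0 ≤ z) : Real.exp (-z) ≤ 1 - z + z ^ 2 / 2 := by
  have h1 := Real.quadratic_le_exp_of_nonneg hz
  have h2 : Real.exp (-z) * Real.exp z = 1 := by rw [← Real.exp_add]; simp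
  have h3 : 0 < Real.exp (-z) := Real.exp_pos _
  have h4 : Real.exp (-z) * (1 + z + z ^ 2 / 2) ≤ 1 :=
    (mul_le_mul_of_nonneg_left h1 h3.le).trans h2.le
  have h5 : 0 < 1 + z + z ^ 2 / 2 := by positivity
  refine le_of_mul_le_mul_right (h4.trans ?_) h5
  nlinarith [sq_nonneg (z ^ 2)]

/-- The implicit-exploration estimate is dominated by a logarithm. -/
theorem implicit_exploration_le_log {x π γ α : ℝ} (hx : 0 ≤ x) (hx1 : x ≤ 1) (hπ : 0 < π)
    (hα : 0 ≤ α) (hαγ : α ≤ 2 * γ) : α * (x / (π + γ)) ≤ Real.log (1 + α / π * x) := by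
  have hz : 0 ≤ α / π * x := by positivity
  -- The bound 2z/(z + 2) ≤ log(1 + z) at z = αx/π reduces the claim to αx ≤ 2γ.
  refine le_trans ?_ (Real.le_log_one_add_of_nonneg hz)
  have hγ : 0 ≤ γ := by linarith
  have h1 : 2 * (α / π * x) / (α / π * x + 2) = 2 * (α * x) / (α * x + 2 * π) := by
    field_simp
  rw [h1, ← mul_div_assoc, div_le_div_iff₀ (by positivity) (by positivity)]
  have h2 : α * x ≤ 2 * γ := by nlinarith
  nlinarith [mul_nonneg hα hx]

/-- On [0, l] the convex function exp lies below its chord. This serves the case of a single action.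
-/
theorem mul_le_log_chord {x l : ℝ} (hx : 0 ≤ x) (hx1 : x ≤ 1) :
    l * x ≤ Real.log (1 + (Real.exp l - 1) * x) := by
  have h := convexOn_exp.2 (Set.mem_univ (0 : ℝ)) (Set.mem_univ l)
    (sub_nonneg.2 hx1) hx (by ring)
  simp only [smul_eq_mul, mul_zero, zero_add, Real.exp_zero, mul_one] at h
  have h2 : 1 - x + x * Real.exp l = 1 + (Real.exp l - 1) * x := by ring
  rw [h2] at h
  rw [Real.le_log_iff_exp_le (lt_of_lt_of_le (Real.exp_pos _) h), mul_comm]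
  exact h

/-! ### The potential of exponential weights -/

/-- The potential `(1/η) log ((1/K) ∑ exp(-η L(j)))` of exponential weights. -/
noncomputable def expPotential {ι : Type*} [Fintype ι] (η : ℝ) (L : ι → ℝ) : ℝ :=
  Real.log ((∑ j, Real.exp (-(η * L j))) / Fintype.card ι) / η

section Potential

variable {ι : Type*} [Fintype ι] [Nonempty ι]

theorem sum_exp_pos (f : ι → ℝ) : 0 < ∑ j, Real.exp (f j) :=
  Finset.sum_pos (fun _ _ => Real.exp_pos _) Finset.univ_nonempty

theorem expPotential_zero (η : ℝ) : expPotential η (fun _ : ι => 0) = 0 := by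
  simp [expPotential]

/-- The power mean inequality with uniform weights and exponent η'/η. It lets the step size decrease
over time without loss. -/
theorem expPotential_mono {η η' : ℝ} (hη : 0 < η) (h : η ≤ η') (L : ι → ℝ) :
    expPotential η L ≤ expPotential η' L := by
  have hη' : 0 < η' := hη.trans_le h
  have hc : (0 : ℝ) < Fintype.card ι := by exact_mod_cast Fintype.card_pos
  have hr : 1 ≤ η' / η := (one_le_div hη).2 h
  have key := Real.rpow_arith_mean_le_arith_mean_rpow Finset.univ
    (fun _ : ι => (1 : ℝ) / Fintype.card ι) (fun j => Real.exp (-(η * L j)))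
    (fun _ _ => by positivity) (by simp) (fun _ _ => (Real.exp_pos _).le) hr
  simp only [← Finset.mul_sum] at key
  have h1 : ∀ j, Real.exp (-(η * L j)) ^ (η' / η) = Real.exp (-(η' * L j)) := fun j => by
    rw [← Real.exp_mul]; congr 1; field_simp
  simp only [h1] at key
  have hp := sum_exp_pos fun j => -(η * L j)
  have hp' := sum_exp_pos fun j => -(η' * L j)
  have hlog := Real.log_le_log (by positivity) key
  rw [Real.log_rpow (by positivity)] at hlog
  unfold expPotential
  rw [div_le_div_iff₀ hη hη', div_eq_mul_one_div (∑ j, Real.exp (-(η * L j))),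
    div_eq_mul_one_div (∑ j, Real.exp (-(η' * L j))), mul_comm (∑ j, Real.exp (-(η * L j))),
    mul_comm (∑ j, Real.exp (-(η' * L j)))]
  calc _ = (η' / η * Real.log (1 / ↑(Fintype.card ι) * ∑ i, Real.exp (-(η * L i)))) * η := by
        field_simp
    _ ≤ _ := mul_le_mul_of_nonneg_right hlog hη.le

theorem neg_expPotential_le {η : ℝ} (hη : 0 < η) (L : ι → ℝ) (j : ι) :
    -expPotential η L ≤ Real.log (Fintype.card ι) / η + L j := by
  have hc : (0 : ℝ) < Fintype.card ι := by exact_mod_cast Fintype.card_pos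
  have hp := sum_exp_pos fun j => -(η * L j)
  have h1 : Real.exp (-(η * L j)) ≤ ∑ j, Real.exp (-(η * L j)) :=
    Finset.single_le_sum (f := fun j => Real.exp (-(η * L j)))
      (fun _ _ => (Real.exp_pos _).le) (Finset.mem_univ j)
  have h2 := Real.log_le_log (Real.exp_pos _) h1
  rw [Real.log_exp] at h2
  unfold expPotential
  rw [Real.log_div hp.ne' hc.ne', ← neg_div, div_le_iff₀ hη, add_mul, div_mul_cancel₀ _ hη.ne']
  linarith

/-- A one-coordinate update multiplies the sum of exponentials by 1 + π(exp(-ηl) - 1); the claim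
follows from log y ≤ y - 1 and exp(-z) ≤ 1 - z + z²/2. -/
theorem expPotential_update_le [DecidableEq ι] {η : ℝ} (hη : 0 < η) (L : ι → ℝ) (i : ι) {l : ℝ}
    (hl : 0 ≤ l) :
    expPotential η (fun j => L j + if j = i then l else 0) ≤ expPotential η L
      - (Real.exp (-(η * L i)) / ∑ j, Real.exp (-(η * L j))) * (l - η / 2 * l ^ 2) := by
  have hc : (0 : ℝ) < Fintype.card ι := by exact_mod_cast Fintype.card_pos
  have hp := sum_exp_pos fun j => -(η * L j)
  have hp' := sum_exp_pos fun j => -(η * (L j + if j = i then l else 0))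
  set S := ∑ j, Real.exp (-(η * L j)) with hS
  set π := Real.exp (-(η * L i)) / S with hπ
  have hπ0 : 0 < π := div_pos (Real.exp_pos _) hp
  have hsum : ∑ j, Real.exp (-(η * (L j + if j = i then l else 0)))
      = S + Real.exp (-(η * L i)) * (Real.exp (-(η * l)) - 1) := by
    have : ∀ j, Real.exp (-(η * (L j + if j = i then l else 0))) = Real.exp (-(η * L j))
        + if j = i then Real.exp (-(η * L i)) * (Real.exp (-(η * l)) - 1) else 0 := fun j => by
      split_ifs with h
      · subst h
        rw [mul_add, neg_add, Real.exp_add]; ring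
      · simp
    simp only [this, Finset.sum_add_distrib, Finset.sum_ite_eq', Finset.mem_univ, if_true, hS]
  have hprod : ∑ j, Real.exp (-(η * (L j + if j = i then l else 0)))
      = S * (1 + π * (Real.exp (-(η * l)) - 1)) := by
    rw [hsum, hπ]; field_simp
  have hpos : 0 < 1 + π * (Real.exp (-(η * l)) - 1) := by
    rw [hprod] at hp'
    exact (mul_pos_iff_of_pos_left hp).1 hp'
  have hlog : Real.log (1 + π * (Real.exp (-(η * l)) - 1)) ≤ π * (-(η * l) + (η * l) ^ 2 / 2) := by
    refine (Real.log_le_sub_one_of_pos hpos).trans ?_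
    have := exp_neg_le_quadratic (mul_nonneg hη.le hl)
    nlinarith
  unfold expPotential
  rw [hprod, mul_div_right_comm, Real.log_mul (by positivity) hpos.ne', add_div]
  have : Real.log (1 + π * (Real.exp (-(η * l)) - 1)) / η ≤ -(π * (l - η / 2 * l ^ 2)) := by
    rw [div_le_iff₀ hη]
    refine hlog.trans (le_of_eq (by ring))
  linarith

end Potential

/-! ### Step sizes -/

theorem anytimeStep_nonneg (K t : ℕ) : 0 ≤ anytimeStep K t := Real.sqrt_nonneg _

theorem anytimeStep_pos {K t : ℕ} (hK : 2 ≤ K) (ht : 1 ≤ t) : 0 < anytimeStep K t := by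
  have h1 : (1 : ℝ) < K := by exact_mod_cast hK
  have h2 : (0 : ℝ) < t := by exact_mod_cast ht
  have := Real.log_pos h1
  exact Real.sqrt_pos.2 (by positivity)

theorem anytimeStep_antitone {K s t : ℕ} (hs : 1 ≤ s) (hst : s ≤ t) :
    anytimeStep K t ≤ anytimeStep K s := by
  refine Real.sqrt_le_sqrt ?_
  rcases Nat.eq_zero_or_pos K with rfl | hK
  · simp
  have h1 : (0 : ℝ) < K := by exact_mod_cast hK
  have h2 : (0 : ℝ) < s := by exact_mod_cast hs
  have h3 : (s : ℝ) ≤ t := by exact_mod_cast hst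
  exact div_le_div_of_nonneg_left (Real.log_natCast_nonneg K) (by positivity) (by gcongr)

theorem anytimeStep_eq (K t : ℕ) :
    anytimeStep K t = Real.sqrt (Real.log K / K) * (1 / Real.sqrt t) := by
  rw [anytimeStep, ← div_div, Real.sqrt_div' _ (Nat.cast_nonneg t)]; ring

theorem one_div_sqrt_succ_le (n : ℕ) :
    1 / Real.sqrt ((n + 1 : ℕ) : ℝ)
      ≤ 2 * (Real.sqrt ((n + 1 : ℕ) : ℝ) - Real.sqrt n) := by
  have h0 : (0 : ℝ) ≤ n := n.cast_nonneg
  push_cast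
  have h1 : 0 < Real.sqrt ((n : ℝ) + 1) := Real.sqrt_pos.2 (by positivity)
  have h2 := Real.sq_sqrt h0
  have h3 := Real.sq_sqrt (by positivity : (0 : ℝ) ≤ (n : ℝ) + 1)
  rw [div_le_iff₀ h1]
  nlinarith [sq_nonneg (Real.sqrt ((n : ℝ) + 1) - Real.sqrt n)]

/-! ### The exploring rounds -/

/-- Round `s + 1` explores. -/
abbrev Explores (q : ℕ → ℝ) (v : ℝ) (s : ℕ) : Prop :=
  exploreCount q v s < exploreCount q v (s + 1)

/-- The number of exploring rounds among the first `t` rounds. -/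
noncomputable def exploreRounds (q : ℕ → ℝ) (v : ℝ) (t : ℕ) : ℕ :=
  ∑ s ∈ Finset.range t, if Explores q v s then 1 else 0

theorem exploreRounds_succ (q : ℕ → ℝ) (v : ℝ) (t : ℕ) :
    exploreRounds q v (t + 1) = exploreRounds q v t + if Explores q v t then 1 else 0 :=
  Finset.sum_range_succ _ _

theorem exploreRounds_mono (q : ℕ → ℝ) (v : ℝ) : Monotone (exploreRounds q v) :=
  monotone_nat_of_le_succ fun t => by rw [exploreRounds_succ]; omega

theorem cast_exploreRounds (q : ℕ → ℝ) (v : ℝ) (t : ℕ) :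
    (exploreRounds q v t : ℝ) = ∑ s ∈ Finset.range t, if Explores q v s then (1 : ℝ) else 0 := by
  simp [exploreRounds]

theorem exploreRounds_succ_le {q : ℕ → ℝ} {v : ℝ} {s t : ℕ} (hst : s < t) (hs : Explores q v s) :
    exploreRounds q v s + 1 ≤ exploreRounds q v t := by
  have h := exploreRounds_mono q v (Nat.succ_le_of_lt hst)
  rw [Nat.succ_eq_add_one, exploreRounds_succ, if_pos hs] at h
  exact h

/-- The sum runs over the internal clock of EXP3-IX, and 1/√(n+1) ≤ 2(√(n+1) - √n) telescopes along
it. -/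
theorem sum_anytimeStep_le (K : ℕ) (q : ℕ → ℝ) (v : ℝ) (t : ℕ) :
    (∑ s ∈ Finset.range t, if Explores q v s then anytimeStep K (exploreRounds q v s + 1) else 0)
      ≤ 2 * Real.sqrt (Real.log K / K) * Real.sqrt (exploreRounds q v t) := by
  induction t with
  | zero => simp [exploreRounds]
  | succ t ih =>
    rw [Finset.sum_range_succ, exploreRounds_succ]
    split_ifs with h
    · have h1 := one_div_sqrt_succ_le (exploreRounds q v t)
      rw [anytimeStep_eq]
      have h2 := mul_le_mul_of_nonneg_left h1 (Real.sqrt_nonneg (Real.log K / K))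
      linarith
    · simpa using ih

/-- As each q is at most 1, the counter rises by at most one per round after the first, so its rises
can be counted. The bound does not depend on the seed. -/
theorem floor_sum_le_exploreRounds {q : ℕ → ℝ} (hq0 : ∀ t, 0 ≤ q t) (hq1 : ∀ t, q t ≤ 1)
    (hq : q 1 = 1) {v : ℝ} (hv : 0 ≤ v) (t : ℕ) :
    ⌊∑ i ∈ Finset.Icc 1 t, q i⌋₊ ≤ exploreRounds q v t := by
  have hS : ∀ t, 0 ≤ ∑ i ∈ Finset.Icc 1 t, q i := fun t => Finset.sum_nonneg fun i _ => hq0 i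
  -- The summand ⌊v⌋ absorbs the start: the counter is 0 at time 0 rather than ⌊v⌋, so for v = 1 it
  -- jumps by two in round 1, which is a single exploring round.
  have key : ∀ t, ⌊(∑ i ∈ Finset.Icc 1 (t + 1), q i) + v⌋₊
      ≤ exploreRounds q v (t + 1) + ⌊v⌋₊ := by
    intro t
    induction t with
    | zero =>
      have h1 : ⌊(∑ i ∈ Finset.Icc 1 (0 + 1), q i) + v⌋₊ = ⌊v⌋₊ + 1 := by
        simp only [zero_add, Finset.Icc_self, Finset.sum_singleton, hq]
        rw [add_comm, Nat.floor_add_one hv]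
      have h2 : Explores q v 0 := by
        simp only [Explores, exploreCount]
        rw [h1]; omega
      rw [exploreRounds_succ, if_pos h2, h1]; omega
    | succ t ih =>
      rw [exploreRounds_succ]
      have h1 : ⌊(∑ i ∈ Finset.Icc 1 (t + 1 + 1), q i) + v⌋₊
          ≤ ⌊(∑ i ∈ Finset.Icc 1 (t + 1), q i) + v⌋₊ + 1 := by
        rw [← Nat.floor_add_one (add_nonneg (hS _) hv),
          Finset.sum_Icc_succ_top (by omega : 1 ≤ t + 1 + 1)]
        exact Nat.floor_le_floor (by linarith [hq1 (t + 1 + 1)])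
      split_ifs with h
      · omega
      · simp only [Explores, exploreCount, not_lt] at h
        omega
  rcases t with _ | t
  · simp
  · have h1 : ⌊∑ i ∈ Finset.Icc 1 (t + 1), q i⌋₊ + ⌊v⌋₊
        ≤ ⌊(∑ i ∈ Finset.Icc 1 (t + 1), q i) + v⌋₊ := by
      refine Nat.le_floor ?_
      push_cast
      exact add_le_add (Nat.floor_le (hS _)) (Nat.floor_le hv)
    have h2 := key t
    omega

/-! ### EXP3-IX in the explore-or-exploit scheme along one path -/

section Path

variable {K : ℕ} (q : ℕ → ℝ) (v : ℝ) (act : ℕ → Fin K) (x : ℕ → ℝ)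

/-- The state of EXP3-IX after `t` rounds of the explore-or-exploit scheme. -/
noncomputable def ixState (t : ℕ) : Exp3IXState (Fin K) :=
  eoeState (anytimeExp3IX K) q v act x t

/-- The policy of EXP3-IX after `t` rounds of the explore-or-exploit scheme. -/
noncomputable def ixPolicy (t : ℕ) : Fin K → ℝ :=
  (ixState q v act x t).policy (anytimeStep K)

/-- The estimate of the loss of the action played in round `t + 1`. -/
noncomputable def ixEstimate (t : ℕ) : ℝ :=
  x (t + 1) / (ixPolicy q v act x t (act (t + 1))
    + anytimeStep K (exploreRounds q v t + 1) / 2)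

theorem ixState_zero : ixState q v act x 0 = ⟨0, fun _ => 0, fun _ => 0⟩ := rfl

theorem ixState_succ_round (t : ℕ) : (ixState q v act x (t + 1)).round
    = (ixState q v act x t).round + if Explores q v t then 1 else 0 := by
  unfold ixState
  rw [eoeState]
  split_ifs <;> rfl

/-- EXP3-IX counts its own updates. This is not always `exploreCount`, which is larger by one from
round 1 on when the seed equals 1 and the probabilities are those of the scheme. -/
theorem ixState_round (t : ℕ) : (ixState q v act x t).round = exploreRounds q v t := by
  induction t with
  | zero => rfl
  | succ t ih => rw [ixState_succ_round, exploreRounds_succ, ih]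

theorem ixState_succ_estLoss (t : ℕ) (j : Fin K) : (ixState q v act x (t + 1)).estLoss j
    = (ixState q v act x t).estLoss j
      + if Explores q v t then (if j = act (t + 1) then ixEstimate q v act x t else 0) else 0 := by
  unfold ixEstimate
  rw [← ixState_round q v act x]
  unfold ixPolicy ixState
  rw [eoeState]
  split_ifs with h h'
  · subst h'
    simp [anytimeExp3IX, exp3IX]
  · simp [anytimeExp3IX, exp3IX, h']
  · simp

theorem ixState_succ_policySum (t : ℕ) (j : Fin K) : (ixState q v act x (t + 1)).policySum j
    = (ixState q v act x t).policySum j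
      + if Explores q v t then ixPolicy q v act x t j else 0 := by
  unfold ixPolicy ixState
  rw [eoeState]
  split_ifs with h
  · rfl
  · simp

theorem ixState_estLoss (t : ℕ) (j : Fin K) : (ixState q v act x t).estLoss j
    = ∑ s ∈ Finset.range t,
      if Explores q v s then (if j = act (s + 1) then ixEstimate q v act x s else 0) else 0 := by
  induction t with
  | zero => rfl
  | succ t ih => rw [ixState_succ_estLoss, ih, Finset.sum_range_succ]

theorem ixState_policySum (t : ℕ) (j : Fin K) : (ixState q v act x t).policySum j
    = ∑ s ∈ Finset.range t, if Explores q v s then ixPolicy q v act x s j else 0 := by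
  induction t with
  | zero => rfl
  | succ t ih => rw [ixState_succ_policySum, ih, Finset.sum_range_succ]

theorem ixPolicy_eq (t : ℕ) (j : Fin K) : ixPolicy q v act x t j
    = Real.exp (-(anytimeStep K (exploreRounds q v t + 1) * (ixState q v act x t).estLoss j)) /
      ∑ i, Real.exp (-(anytimeStep K (exploreRounds q v t + 1)
        * (ixState q v act x t).estLoss i)) := by
  rw [ixPolicy, Exp3IXState.policy, ixState_round]

variable [NeZero K]

theorem ixPolicy_pos (t : ℕ) (j : Fin K) : 0 < ixPolicy q v act x t j := by
  rw [ixPolicy_eq]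
  exact div_pos (Real.exp_pos _) (sum_exp_pos _)

theorem sum_ixPolicy (t : ℕ) : ∑ j, ixPolicy q v act x t j = 1 := by
  simp only [ixPolicy_eq, ← Finset.sum_div]
  exact div_self (sum_exp_pos _).ne'

theorem ixPolicy_mem (t : ℕ) : ixPolicy q v act x t ∈ stdSimplex ℝ (Fin K) :=
  ⟨fun j => (ixPolicy_pos q v act x t j).le, sum_ixPolicy q v act x t⟩

theorem ixEstimate_nonneg {t : ℕ} (hx : 0 ≤ x (t + 1)) : 0 ≤ ixEstimate q v act x t :=
  div_nonneg hx (add_nonneg (ixPolicy_pos q v act x t _).le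
    (div_nonneg (anytimeStep_nonneg _ _) zero_le_two))

/-- The potential argument: the total loss of EXP3-IX in its exploring rounds. -/
theorem sum_loss_le_potential (hK : 2 ≤ K) (hx0 : ∀ s, 0 ≤ x (s + 1)) (hx1 : ∀ s, x (s + 1) ≤ 1)
    (t : ℕ) {η : ℝ} (hη : 0 < η)
    (hηt : 1 ≤ exploreRounds q v t → η ≤ anytimeStep K (exploreRounds q v t)) :
    (∑ s ∈ Finset.range t, if Explores q v s then x (s + 1) else 0)
      ≤ -expPotential η (ixState q v act x t).estLoss
        + ∑ s ∈ Finset.range t, if Explores q v s then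
          anytimeStep K (exploreRounds q v s + 1) * ixEstimate q v act x s else 0 := by
  induction t generalizing η with
  | zero => simp [ixState_zero, expPotential_zero]
  | succ t ih =>
    rw [Finset.sum_range_succ, Finset.sum_range_succ]
    rw [exploreRounds_succ] at hηt
    have hest : (ixState q v act x (t + 1)).estLoss = fun j => (ixState q v act x t).estLoss j
        + if Explores q v t then (if j = act (t + 1) then ixEstimate q v act x t else 0) else 0 :=
      funext fun j => ixState_succ_estLoss q v act x t j
    rw [hest]
    by_cases h : Explores q v t
    · simp only [if_pos h] at hηt ⊢
      set n := exploreRounds q v t with hn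
      set η' := anytimeStep K (n + 1) with hη'
      have hη'0 : 0 < η' := anytimeStep_pos hK (by omega)
      -- The induction hypothesis is used at the step size η' of this update; monotonicity of the
      -- potential then passes to η. The guard on the number of rounds is needed since `anytimeStep
      -- K 0 = 0`.
      have h1 := ih hη'0 (fun h1 => anytimeStep_antitone h1 (by omega))
      have h2 := expPotential_update_le hη'0 (ixState q v act x t).estLoss (act (t + 1))
        (ixEstimate_nonneg q v act x (hx0 t))
      have h3 := expPotential_mono hη (hηt (by omega)) (fun j => (ixState q v act x t).estLoss j
        + if j = act (t + 1) then ixEstimate q v act x t else 0)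
      rw [← ixPolicy_eq q v act x t] at h2
      set l := ixEstimate q v act x t with hl
      have hl0 : 0 ≤ l := ixEstimate_nonneg q v act x (hx0 t)
      set π := ixPolicy q v act x t (act (t + 1)) with hπ
      have hπ0 : 0 < π := ixPolicy_pos q v act x t _
      have hl' : l * (π + η' / 2) = x (t + 1) := by
        rw [hl, ixEstimate, ← hn, ← hη', ← hπ]
        exact div_mul_cancel₀ _ (by positivity)
      have hπl : π * l ≤ 1 := by nlinarith [hx1 t]
      -- One half of η'l is the bias of implicit exploration, x = l(π + η'/2); the other half pays
      -- for the quadratic term, because πl ≤ 1.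
      have h4 : x (t + 1) - η' * l ≤ π * (l - η' / 2 * l ^ 2) := by
        nlinarith [mul_nonneg (mul_nonneg hη'0.le hl0) (sub_nonneg.2 hπl)]
      linarith
    · simp only [if_neg h, add_zero] at hηt ⊢
      exact ih hη hηt

theorem sum_loss_le (hK : 2 ≤ K) (hx0 : ∀ s, 0 ≤ x (s + 1)) (hx1 : ∀ s, x (s + 1) ≤ 1)
    (t : ℕ) (ht : 1 ≤ exploreRounds q v t) (j : Fin K) :
    (∑ s ∈ Finset.range t, if Explores q v s then x (s + 1) else 0)
      ≤ Real.log K / anytimeStep K (exploreRounds q v t)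
        + (∑ s ∈ Finset.range t,
          if Explores q v s then (if j = act (s + 1) then ixEstimate q v act x s else 0) else 0)
        + ∑ s ∈ Finset.range t, if Explores q v s then
          anytimeStep K (exploreRounds q v s + 1) * ixEstimate q v act x s else 0 := by
  have hη := anytimeStep_pos hK ht
  have h1 := sum_loss_le_potential q v act x hK hx0 hx1 t hη (fun _ => le_rfl)
  have h2 := neg_expPotential_le hη (ixState q v act x t).estLoss j
  rw [ixState_estLoss, Fintype.card_fin] at h2
  linarith

end Path

open scoped ENNReal

/-! ### An exponential supermartingale for bandit feedback -/

theorem measurable_eval_fin {Ω : Type*} [MeasurableSpace Ω] {K : ℕ} {f : Ω → Fin K → ℝ}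
    {i : Ω → Fin K} (hf : Measurable f) (hi : Measurable i) : Measurable fun w => f w (i w) := by
  have : (fun w => f w (i w)) = fun w => ∑ j, if i w = j then f w j else 0 := by
    ext w; simp
  rw [this]
  exact Finset.measurable_sum _ fun j _ => Measurable.ite (hi (measurableSet_singleton j))
    ((measurable_pi_apply j).comp hf) measurable_const

/-- A player with `K` actions receives bandit feedback: in round `t + 1` it plays the action
`act (t + 1)`, drawn from `π t`, and observes the loss `x (t + 1)`, whose mean given the past and
the action `i` is `m t i`. -/
structure BanditFeedback {Ω : Type*} {m0 : MeasurableSpace Ω} (𝓕 : Filtration ℕ m0)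
    (P : Measure Ω) {K : ℕ} (act : ℕ → Ω → Fin K) (x : ℕ → Ω → ℝ) (π m : ℕ → Ω → Fin K → ℝ) :
    Prop where
  measurable_act : ∀ t, Measurable[𝓕 (t + 1)] (act (t + 1))
  measurable_obs : ∀ t, Measurable[𝓕 (t + 1)] (x (t + 1))
  measurable_policy : ∀ t, Measurable[𝓕 t] (π t)
  measurable_mean : ∀ t, Measurable[𝓕 t] (m t)
  policy_nonneg : ∀ t w i, 0 ≤ π t w i
  mean_nonneg : ∀ t w i, 0 ≤ m t w i
  mean_le_one : ∀ t w i, m t w i ≤ 1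
  obs_mem : ∀ᵐ w ∂P, ∀ t, x (t + 1) w ∈ Set.Icc 0 1
  sampling : ∀ (t : ℕ) (i : Fin K) (φ : Ω → ℝ≥0∞), Measurable[𝓕 t] φ →
    ∫⁻ w, φ w * (if act (t + 1) w = i then ENNReal.ofReal (x (t + 1) w) else 0) ∂P
      = ∫⁻ w, φ w * ENNReal.ofReal (π t w i * m t w i) ∂P

/-- The process `∏ (1 + βˢ(aˢ) xˢ) exp(-∑ᵢ βˢ(i) πˢ(i) mˢ(i))`. -/
noncomputable def expProduct {Ω : Type*} {K : ℕ} (act : ℕ → Ω → Fin K) (x : ℕ → Ω → ℝ)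
    (π m β : ℕ → Ω → Fin K → ℝ) (t : ℕ) (w : Ω) : ℝ≥0∞ :=
  ∏ s ∈ Finset.range t,
    (1 + ENNReal.ofReal (β s w (act (s + 1) w)) * ENNReal.ofReal (x (s + 1) w))
      * ENNReal.ofReal (Real.exp (-∑ i, β s w i * (π s w i * m s w i)))

section ExpProcess

variable {Ω : Type*} {K : ℕ} {act : ℕ → Ω → Fin K} {x : ℕ → Ω → ℝ} {π m β : ℕ → Ω → Fin K → ℝ}

theorem measurable_compensator [MeasurableSpace Ω] {β π m : Ω → Fin K → ℝ} (hβ : Measurable β)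
    (hπ : Measurable π) (hm : Measurable m) :
    Measurable fun w => ENNReal.ofReal (Real.exp (-∑ i, β w i * (π w i * m w i))) := by
  have h1 := fun i => (measurable_pi_apply i).comp hβ
  have h2 := fun i => (measurable_pi_apply i).comp hπ
  have h3 := fun i => (measurable_pi_apply i).comp hm
  exact (Finset.measurable_sum _ fun i _ =>
    (h1 i).mul ((h2 i).mul (h3 i))).neg.exp.ennreal_ofReal

theorem measurable_expProduct [MeasurableSpace Ω] {t : ℕ}
    (hact : ∀ s < t, Measurable (act (s + 1))) (hx : ∀ s < t, Measurable (x (s + 1)))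
    (hπ : ∀ s < t, Measurable (π s)) (hm : ∀ s < t, Measurable (m s))
    (hβ : ∀ s < t, Measurable (β s)) : Measurable (expProduct act x π m β t) := by
  refine Finset.measurable_fun_prod _ fun s hs => ?_
  have hs := Finset.mem_range.1 hs
  exact ((measurable_eval_fin (hβ s hs) (hact s hs)).ennreal_ofReal.mul
    (hx s hs).ennreal_ofReal |>.const_add 1).mul
    (measurable_compensator (hβ s hs) (hπ s hs) (hm s hs))

theorem BanditFeedback.adapted_expProduct {m0 : MeasurableSpace Ω} {𝓕 : Filtration ℕ m0}
    {P : Measure Ω} (h : BanditFeedback 𝓕 P act x π m) (hβ : ∀ s, Measurable[𝓕 s] (β s)) (t : ℕ) :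
    Measurable[𝓕 t] (expProduct act x π m β t) :=
  @measurable_expProduct Ω K act x π m β (𝓕 t) t
    (fun s hs => (h.measurable_act s).mono (𝓕.mono hs) le_rfl)
    (fun s hs => (h.measurable_obs s).mono (𝓕.mono hs) le_rfl)
    (fun s hs => (h.measurable_policy s).mono (𝓕.mono hs.le) le_rfl)
    (fun s hs => (h.measurable_mean s).mono (𝓕.mono hs.le) le_rfl)
    (fun s hs => (hβ s).mono (𝓕.mono hs.le) le_rfl)

/-- Given the past, the new factor has mean (1 + S) exp(-S) ≤ 1, where S is the sum of the β(i) π(i)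
m(i). In `ℝ≥0∞` this needs no integrability, although weights such as η/π are unbounded. -/
theorem BanditFeedback.lintegral_expProduct_le {m0 : MeasurableSpace Ω} {𝓕 : Filtration ℕ m0}
    {P : Measure Ω} [IsProbabilityMeasure P] (h : BanditFeedback 𝓕 P act x π m)
    (hβ : ∀ s, Measurable[𝓕 s] (β s)) (hβ0 : ∀ s w i, 0 ≤ β s w i) (t : ℕ) :
    ∫⁻ w, expProduct act x π m β t w ∂P ≤ 1 := by
  induction t with
  | zero => simp [expProduct]
  | succ t ih =>
    set c : Ω → ℝ≥0∞ := fun w =>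
      ENNReal.ofReal (Real.exp (-∑ i, β t w i * (π t w i * m t w i))) with hc
    set E := expProduct act x π m β t with hE
    have hEm : Measurable[𝓕 t] E := h.adapted_expProduct hβ t
    have hcm : Measurable[𝓕 t] c :=
      @measurable_compensator Ω K (𝓕 t) _ _ _ (hβ t) (h.measurable_policy t) (h.measurable_mean t)
    have hφ : ∀ i, Measurable[𝓕 t] fun w => E w * c w * ENNReal.ofReal (β t w i) := fun i =>
      (hEm.mul hcm).mul (Measurable.ennreal_ofReal ((measurable_pi_apply i).comp (hβ t)))
    have hind : ∀ i, Measurable fun w =>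
        if act (t + 1) w = i then ENNReal.ofReal (x (t + 1) w) else 0 := fun i =>
      Measurable.ite (((h.measurable_act t).mono (𝓕.le _) le_rfl) (measurableSet_singleton i))
        (((h.measurable_obs t).mono (𝓕.le _) le_rfl).ennreal_ofReal) measurable_const
    have hEc : Measurable fun w => E w * c w := (hEm.mul hcm).mono (𝓕.le t) le_rfl
    calc ∫⁻ w, expProduct act x π m β (t + 1) w ∂P
        = ∫⁻ w, (E w * c w + ∑ i, E w * c w * ENNReal.ofReal (β t w i)
            * (if act (t + 1) w = i then ENNReal.ofReal (x (t + 1) w) else 0)) ∂P := by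
          refine lintegral_congr fun w => ?_
          simp only [mul_ite, mul_zero, Finset.sum_ite_eq, Finset.mem_univ, if_true]
          rw [expProduct, Finset.prod_range_succ, hE, hc]
          simp only [expProduct]
          ring
      _ = ∫⁻ w, E w * c w ∂P + ∑ i, ∫⁻ w, E w * c w * ENNReal.ofReal (β t w i)
            * ENNReal.ofReal (π t w i * m t w i) ∂P := by
          rw [lintegral_add_left hEc, lintegral_finsetSum]
          · congr 1
            exact Finset.sum_congr rfl fun i _ => h.sampling t i _ (hφ i)
          · exact fun i _ => ((hφ i).mono (𝓕.le t) le_rfl).mul (hind i)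
      _ = ∫⁻ w, E w * (c w * (1 + ∑ i, ENNReal.ofReal (β t w i)
            * ENNReal.ofReal (π t w i * m t w i))) ∂P := by
          rw [← lintegral_finsetSum, ← lintegral_add_left hEc]
          · refine lintegral_congr fun w => ?_
            rw [mul_add, mul_add, Finset.mul_sum, Finset.mul_sum, mul_one]
            congr 1
            exact Finset.sum_congr rfl fun i _ => by ring
          · intro i _
            refine ((hφ i).mono (𝓕.le t) le_rfl).mul (Measurable.ennreal_ofReal ?_)
            exact ((measurable_pi_apply i).comp ((h.measurable_policy t).mono (𝓕.le t) le_rfl)).mul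
              ((measurable_pi_apply i).comp ((h.measurable_mean t).mono (𝓕.le t) le_rfl))
      _ ≤ ∫⁻ w, E w ∂P := by
          refine lintegral_mono fun w => ?_
          have h0 : ∀ i, 0 ≤ β t w i * (π t w i * m t w i) := fun i =>
            mul_nonneg (hβ0 t w i) (mul_nonneg (h.policy_nonneg t w i) (h.mean_nonneg t w i))
          have h1 : ∑ i, ENNReal.ofReal (β t w i) * ENNReal.ofReal (π t w i * m t w i)
              = ENNReal.ofReal (∑ i, β t w i * (π t w i * m t w i)) := by
            rw [ENNReal.ofReal_sum_of_nonneg fun i _ => h0 i]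
            exact Finset.sum_congr rfl fun i _ => (ENNReal.ofReal_mul (hβ0 t w i)).symm
          set S := ∑ i, β t w i * (π t w i * m t w i) with hS
          have hS0 : 0 ≤ S := Finset.sum_nonneg fun i _ => h0 i
          have h2 : c w * (1 + ENNReal.ofReal S) ≤ 1 := by
            rw [hc, ← ENNReal.ofReal_one, ← ENNReal.ofReal_add zero_le_one hS0,
              ← ENNReal.ofReal_mul (Real.exp_pos _).le]
            refine ENNReal.ofReal_le_ofReal ?_
            have h3 := Real.add_one_le_exp S
            have h4 : Real.exp (-S) * Real.exp S = 1 := by rw [← Real.exp_add]; simp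
            have h5 := Real.exp_pos (-S)
            nlinarith
          rw [h1]
          exact (mul_le_mul_right h2 _).trans (mul_one _).le
      _ ≤ 1 := ih

/-- Along a path, a bound on the process is a bound on the sum of the logarithms. -/
theorem sum_log_le_of_expProduct_le {w : Ω} {t : ℕ} {L : ℝ} (hβ0 : ∀ s i, 0 ≤ β s w i)
    (hx : ∀ s, 0 ≤ x (s + 1) w) (h : expProduct act x π m β t w ≤ ENNReal.ofReal (Real.exp L)) :
    ∑ s ∈ Finset.range t, Real.log (1 + β s w (act (s + 1) w) * x (s + 1) w)
      ≤ L + ∑ s ∈ Finset.range t, ∑ i, β s w i * (π s w i * m s w i) := by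
  have h1 : expProduct act x π m β t w = ENNReal.ofReal (Real.exp (∑ s ∈ Finset.range t,
      (Real.log (1 + β s w (act (s + 1) w) * x (s + 1) w)
        - ∑ i, β s w i * (π s w i * m s w i)))) := by
    rw [Real.exp_sum, ENNReal.ofReal_prod_of_nonneg fun s _ => (Real.exp_pos _).le]
    refine Finset.prod_congr rfl fun s _ => ?_
    have h0 : 0 ≤ β s w (act (s + 1) w) * x (s + 1) w := mul_nonneg (hβ0 s _) (hx s)
    rw [sub_eq_add_neg, Real.exp_add, Real.exp_log (by positivity),
      ENNReal.ofReal_mul (by positivity), ENNReal.ofReal_add zero_le_one h0, ENNReal.ofReal_one,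
      ENNReal.ofReal_mul (hβ0 s _)]
  rw [h1, ENNReal.ofReal_le_ofReal_iff (Real.exp_pos _).le, Real.exp_le_exp,
    Finset.sum_sub_distrib] at h
  linarith

end ExpProcess

/-! ### Measurability of the explore-or-exploit scheme -/

section Measurability

variable {Ω : Type*} {K : ℕ} {q : ℕ → ℝ} {u : Ω → unitInterval} {act : ℕ → Ω → Fin K}
  {x : ℕ → Ω → ℝ}

theorem measurable_exploreCount [MeasurableSpace Ω] (hu : Measurable u) (t : ℕ) :
    Measurable fun w => exploreCount q (u w) t := by
  cases t with
  | zero => exact measurable_const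
  | succ t => exact Nat.measurable_floor.comp ((measurable_subtype_coe.comp hu).const_add _)

theorem measurableSet_explores [MeasurableSpace Ω] (hu : Measurable u) (t : ℕ) :
    MeasurableSet {w | Explores q (u w) t} :=
  measurableSet_lt (measurable_exploreCount hu t) (measurable_exploreCount hu (t + 1))

theorem measurable_exploreRounds [MeasurableSpace Ω] (hu : Measurable u) (t : ℕ) :
    Measurable fun w => exploreRounds q (u w) t :=
  Finset.measurable_sum _ fun s _ =>
    Measurable.ite (measurableSet_explores hu s) measurable_const measurable_const

theorem measurable_step [MeasurableSpace Ω] {n : Ω → ℕ} (hn : Measurable n) :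
    Measurable fun w => anytimeStep K (n w) :=
  (measurable_from_top (f := anytimeStep K)).comp hn

theorem measurable_ixPolicy_of_estLoss [MeasurableSpace Ω] (hu : Measurable u) {t : ℕ}
    (h : ∀ j, Measurable fun w =>
      (ixState q (u w) (fun s => act s w) (fun s => x s w) t).estLoss j) (j : Fin K) :
    Measurable fun w => ixPolicy q (u w) (fun s => act s w) (fun s => x s w) t j := by
  simp only [ixPolicy_eq]
  have h1 : ∀ j, Measurable fun w => Real.exp (-(anytimeStep K (exploreRounds q (u w) t + 1)
      * (ixState q (u w) (fun s => act s w) (fun s => x s w) t).estLoss j)) := fun j =>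
    ((measurable_step ((measurable_exploreRounds hu t).add_const 1)).mul (h j)).neg.exp
  exact (h1 j).div (Finset.measurable_sum _ fun i _ => h1 i)

/-- Estimates and policies determine each other, so the induction alternates between them. The
σ-algebra is arbitrary because the result is needed for each `history`. -/
theorem measurable_estLoss [MeasurableSpace Ω] (hu : Measurable u) (t : ℕ)
    (hact : ∀ s < t, Measurable (act (s + 1))) (hx : ∀ s < t, Measurable (x (s + 1)))
    (j : Fin K) :
    Measurable fun w => (ixState q (u w) (fun s => act s w) (fun s => x s w) t).estLoss j := by
  induction t generalizing j with
  | zero => exact measurable_const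
  | succ t ih =>
    have ih' := ih (fun s hs => hact s (by omega)) (fun s hs => hx s (by omega))
    simp only [ixState_succ_estLoss]
    refine (ih' j).add (Measurable.ite (measurableSet_explores hu t) (Measurable.ite ?_ ?_
      measurable_const) measurable_const)
    · exact measurableSet_eq_fun measurable_const (hact t (by omega))
    · refine (hx t (by omega)).div (Measurable.add ?_
        ((measurable_step ((measurable_exploreRounds hu t).add_const 1)).div_const 2))
      exact measurable_eval_fin (measurable_pi_lambda _ fun i =>
        measurable_ixPolicy_of_estLoss hu ih' i) (hact t (by omega))

theorem measurable_ixPolicy [MeasurableSpace Ω] (hu : Measurable u) (t : ℕ)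
    (hact : ∀ s < t, Measurable (act (s + 1))) (hx : ∀ s < t, Measurable (x (s + 1)))
    (j : Fin K) :
    Measurable fun w => ixPolicy q (u w) (fun s => act s w) (fun s => x s w) t j :=
  measurable_ixPolicy_of_estLoss hu (measurable_estLoss hu t hact hx) j

theorem eoePolicy_succ (v : ℝ) (act : ℕ → Fin K) (x : ℕ → ℝ) (t : ℕ) :
    eoePolicy (anytimeExp3IX K) q v act x (t + 1)
      = if Explores q v t then ixPolicy q v act x t
        else fun j => (∑ s ∈ Finset.range t, if Explores q v s then ixPolicy q v act x s j else 0)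
          / exploreRounds q v t := by
  simp only [← ixState_policySum, ← ixState_round q v act x]
  rfl

theorem measurable_eoePolicy [MeasurableSpace Ω] (hu : Measurable u) (t : ℕ)
    (hact : ∀ s < t, Measurable (act (s + 1))) (hx : ∀ s < t, Measurable (x (s + 1))) :
    Measurable fun w =>
      eoePolicy (anytimeExp3IX K) q (u w) (fun s => act s w) (fun s => x s w) (t + 1) := by
  simp only [eoePolicy_succ]
  refine Measurable.ite (measurableSet_explores hu t) ?_ ?_
  · exact measurable_pi_lambda _ fun j => measurable_ixPolicy hu t hact hx j
  · refine measurable_pi_lambda _ fun j => Measurable.div (Finset.measurable_sum _ fun s hs => ?_)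
      ((measurable_from_top (f := fun n : ℕ => (n : ℝ))).comp (measurable_exploreRounds hu t))
    have hs := Finset.mem_range.1 hs
    exact Measurable.ite (measurableSet_explores hu s) (measurable_ixPolicy hu s
      (fun r hr => hact r (hr.trans hs)) (fun r hr => hx r (hr.trans hs)) j) measurable_const

/-- The hypothesis excludes exploiting before any exploring, when the output would be 0/0 = 0 and
not a policy. -/
theorem eoePolicy_mem [NeZero K] {v : ℝ} (act : ℕ → Fin K) (x : ℕ → ℝ) (t : ℕ)
    (h : Explores q v t ∨ 1 ≤ exploreRounds q v t) :
    eoePolicy (anytimeExp3IX K) q v act x (t + 1) ∈ stdSimplex ℝ (Fin K) := by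
  rw [eoePolicy_succ]
  split_ifs with he
  · exact ixPolicy_mem q v act x t
  · have hn : (0 : ℝ) < exploreRounds q v t := by
      exact_mod_cast h.resolve_left he
    refine ⟨fun j => div_nonneg (Finset.sum_nonneg fun s _ => ?_) hn.le, ?_⟩
    · split_ifs
      · exact (ixPolicy_pos q v act x s j).le
      · exact le_rfl
    · rw [← Finset.sum_div, Finset.sum_comm, div_eq_one_iff_eq hn.ne', cast_exploreRounds]
      refine Finset.sum_congr rfl fun s _ => ?_
      split_ifs
      · exact sum_ixPolicy q v act x s
      · simp

end Measurability

/-! ### The regret of one player -/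

/-- The constant comes from the worst case K = 2, where 1/√(log 2) is about 1.2011. -/
theorem sqrt_log_bounds {K : ℕ} (hK : 2 ≤ K) {L : ℝ} (hL1 : 1 ≤ L) (hL : Real.log K ≤ L) :
    Real.sqrt (Real.log K) ≤ L ∧ 1 / Real.sqrt (Real.log K) ≤ 1.21 := by
  have h2 : Real.log 2 ≤ Real.log K := Real.log_le_log (by norm_num) (by exact_mod_cast hK)
  have h3 := Real.log_two_gt_d9
  constructor
  · rw [Real.sqrt_le_left (by linarith)]; nlinarith
  · have h4 : (1 / 1.21 : ℝ) ≤ Real.sqrt (Real.log K) := by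
      refine Real.le_sqrt_of_sq_le ?_
      norm_num at *; linarith
    rw [div_le_iff₀ (by norm_num at *; linarith)]
    norm_num at *; linarith

/-- The numerical bound on the regret terms of EXP3-IX with at least two actions. -/
theorem regret_terms_le {K n : ℕ} (hK : 2 ≤ K) (hn : 1 ≤ n) {L : ℝ} (hL1 : 1 ≤ L)
    (hL : Real.log K ≤ L) :
    (Real.log K + L) / anytimeStep K n + L
        + K * (2 * Real.sqrt (Real.log K / K) * Real.sqrt n)
      ≤ Real.sqrt n * L * (4.21 * Real.sqrt K + 1) := by
  obtain ⟨h1, h2⟩ := sqrt_log_bounds hK hL1 hL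
  have hK0 : (1 : ℝ) < K := by exact_mod_cast hK
  have hlog := Real.log_pos hK0
  have hl0 : 0 < Real.sqrt (Real.log K) := Real.sqrt_pos.2 hlog
  have hk0 : 0 < Real.sqrt K := Real.sqrt_pos.2 (by linarith)
  have hn1 : (1 : ℝ) ≤ Real.sqrt n := by
    rw [Real.one_le_sqrt]; exact_mod_cast hn
  have hl2 := Real.sq_sqrt hlog.le
  have hk2 := Real.sq_sqrt (by linarith : (0 : ℝ) ≤ K)
  rw [anytimeStep, Real.sqrt_div hlog.le, Real.sqrt_div hlog.le, Real.sqrt_mul (by linarith)]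
  set l := Real.sqrt (Real.log K)
  set k := Real.sqrt K
  set r := Real.sqrt n
  rw [← hl2, ← hk2]
  -- The terms carrying √K sum to 3 l(kr) + (1/l) L(kr); with l ≤ L and 1/l ≤ 1.21 this gives 3 +
  -- 1.21 = 4.21.
  have e1 : (l ^ 2 + L) / (l / (k * r)) = l * (k * r) + 1 / l * (L * (k * r)) := by field_simp
  have e2 : k ^ 2 * (2 * (l / k) * r) = 2 * (l * (k * r)) := by field_simp
  rw [e1, e2]
  have hkr : 0 ≤ k * r := by positivity
  have b1 : l * (k * r) ≤ L * (k * r) := mul_le_mul_of_nonneg_right h1 hkr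
  have b2 : 1 / l * (L * (k * r)) ≤ 1.21 * (L * (k * r)) :=
    mul_le_mul_of_nonneg_right h2 (by positivity)
  have b3 : L ≤ r * L := le_mul_of_one_le_left (by linarith) hn1
  nlinarith

section Player

variable {Ω : Type*} {m0 : MeasurableSpace Ω} {𝓕 : Filtration ℕ m0} {P : Measure Ω}
  [IsProbabilityMeasure P] {K : ℕ} [NeZero K] {act : ℕ → Ω → Fin K} {x : ℕ → Ω → ℝ}
  {π m : ℕ → Ω → Fin K → ℝ} {q : ℕ → ℝ} {u : Ω → unitInterval}

/-- A single V, the sum of K + 1 supermartingales, serves all comparators and all confidence levels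
L: any of the processes is at most V, and Markov's inequality for V replaces a union bound. -/
theorem BanditFeedback.exists_regret_control_of_two_le (hK : 2 ≤ K)
    (h : BanditFeedback 𝓕 P act x π m) (hu : Measurable[𝓕 0] u)
    (hπ : ∀ t w, Explores q (u w) t →
      π t w = ixPolicy q (u w) (fun s => act s w) (fun s => x s w) t) (T : ℕ) :
    ∃ V : Ω → ℝ≥0∞, Measurable V ∧ ∫⁻ w, V w ∂P ≤ K + 1 ∧
      ∀ᵐ w ∂P, 1 ≤ exploreRounds q (u w) T → ∀ (j : Fin K) (L : ℝ), 1 ≤ L → Real.log K ≤ L →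
        V w ≤ ENNReal.ofReal (Real.exp L) →
        (∑ s ∈ Finset.range T, if Explores q (u w) s then x (s + 1) w - m s w j else 0)
          ≤ Real.sqrt (exploreRounds q (u w) T) * L * (4.21 * Real.sqrt K + 1) := by
  have hut : ∀ t, Measurable[𝓕 t] u := fun t => hu.mono (𝓕.mono (Nat.zero_le t)) le_rfl
  have hex : ∀ t, MeasurableSet[𝓕 t] {w | Explores q (u w) t} := fun t =>
    @measurableSet_explores Ω q u (𝓕 t) (hut t) t
  have hη : ∀ t, Measurable[𝓕 t] fun w => anytimeStep K (exploreRounds q (u w) t + 1) := fun t =>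
    @measurable_step Ω K (𝓕 t) _ ((@measurable_exploreRounds Ω q u (𝓕 t) (hut t) t).add_const 1)
  have hηT : ∀ t, Measurable[𝓕 t] fun w => anytimeStep K (exploreRounds q (u w) T) := fun t =>
    @measurable_step Ω K (𝓕 t) _ (@measurable_exploreRounds Ω q u (𝓕 t) (hut t) T)
  have hπm : ∀ t i, Measurable[𝓕 t] fun w => π t w i := fun t i =>
    (measurable_pi_apply i).comp (h.measurable_policy t)
  -- The weights β = η/π govern the estimates of the played actions: each action adds at most η to
  -- the compensator. The weights α of comparator j live on j alone and use the final step size,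
  -- which is at most 2γ in every earlier exploring round.
  set β : ℕ → Ω → Fin K → ℝ := fun s w i => if Explores q (u w) s then
    anytimeStep K (exploreRounds q (u w) s + 1) / π s w i else 0 with hβ
  set α : Fin K → ℕ → Ω → Fin K → ℝ := fun j s w i => if Explores q (u w) s then
    (if j = i then min (anytimeStep K (exploreRounds q (u w) T))
      (anytimeStep K (exploreRounds q (u w) s + 1)) / π s w i else 0) else 0 with hα
  have hβm : ∀ s, Measurable[𝓕 s] (β s) := fun s =>
    @measurable_pi_lambda _ _ _ (𝓕 s) _ _ fun i =>
      Measurable.ite (hex s) ((hη s).div (hπm s i)) measurable_const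
  have hαm : ∀ j s, Measurable[𝓕 s] (α j s) := fun j s =>
    @measurable_pi_lambda _ _ _ (𝓕 s) _ _ fun i =>
      Measurable.ite (hex s) (Measurable.ite (MeasurableSet.const _)
        (((hηT s).min (hη s)).div (hπm s i)) measurable_const) measurable_const
  have hβ0 : ∀ s w i, 0 ≤ β s w i := fun s w i => by
    simp only [hβ]
    split_ifs
    · exact div_nonneg (anytimeStep_nonneg _ _) (h.policy_nonneg s w i)
    · exact le_rfl
  have hα0 : ∀ j s w i, 0 ≤ α j s w i := fun j s w i => by
    simp only [hα]
    split_ifs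
    · exact div_nonneg (le_min (anytimeStep_nonneg _ _) (anytimeStep_nonneg _ _))
        (h.policy_nonneg s w i)
    · exact le_rfl
    · exact le_rfl
  have hEβ : Measurable (expProduct act x π m β T) :=
    (h.adapted_expProduct hβm T).mono (𝓕.le T) le_rfl
  have hEα : ∀ j, Measurable (expProduct act x π m (α j) T) := fun j =>
    (h.adapted_expProduct (hαm j) T).mono (𝓕.le T) le_rfl
  refine ⟨fun w => (∑ j, expProduct act x π m (α j) T w) + expProduct act x π m β T w,
    (Finset.measurable_fun_sum _ fun j _ => hEα j).add hEβ, ?_, ?_⟩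
  · rw [lintegral_add_right _ hEβ, lintegral_finsetSum _ fun j _ => hEα j]
    refine add_le_add ?_ (h.lintegral_expProduct_le hβm hβ0 T)
    refine (Finset.sum_le_sum fun j _ => h.lintegral_expProduct_le (hαm j) (hα0 j) T).trans ?_
    simp
  filter_upwards [h.obs_mem] with w hx hN j L hL1 hL hV
  have hx0 : ∀ s, 0 ≤ x (s + 1) w := fun s => (hx s).1
  have hx1 : ∀ s, x (s + 1) w ≤ 1 := fun s => (hx s).2
  have hπ0 : ∀ s i, Explores q (u w) s → 0 < π s w i := fun s i hs => by
    rw [hπ s w hs]; exact ixPolicy_pos _ _ _ _ _ _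
  set N := exploreRounds q (u w) T with hNdef
  have hηN : 0 < anytimeStep K N := anytimeStep_pos hK hN
  set est := fun s => ixEstimate q (u w) (fun s => act s w) (fun s => x s w) s with hest
  have hest' : ∀ s, Explores q (u w) s → est s = x (s + 1) w / (π s w (act (s + 1) w)
      + anytimeStep K (exploreRounds q (u w) s + 1) / 2) := fun s hs => by
    rw [hest, hπ s w hs]; rfl
  have hVβ := sum_log_le_of_expProduct_le (hβ0 · w) hx0
    ((le_add_left le_rfl).trans hV : expProduct act x π m β T w ≤ _)
  have hVα := sum_log_le_of_expProduct_le (hα0 j · w) hx0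
    (((Finset.single_le_sum (f := fun j => expProduct act x π m (α j) T w)
      (fun _ _ => zero_le) (Finset.mem_univ j)).trans (le_add_right le_rfl)).trans hV)
  have b1 : (∑ s ∈ Finset.range T, if Explores q (u w) s then
      anytimeStep K (exploreRounds q (u w) s + 1) * est s else 0)
      ≤ L + K * (2 * Real.sqrt (Real.log K / K) * Real.sqrt N) := by
    refine (Finset.sum_le_sum fun s _ => ?_).trans (hVβ.trans (add_le_add_right ?_ L))
    · simp only [hβ]
      split_ifs with hs
      · rw [hest' s hs]
        exact implicit_exploration_le_log (hx0 s) (hx1 s) (hπ0 s _ hs) (anytimeStep_nonneg _ _)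
          (by linarith)
      · simp
    · refine le_trans ?_ (mul_le_mul_of_nonneg_left (sum_anytimeStep_le K q (u w) T)
        (Nat.cast_nonneg K))
      rw [Finset.mul_sum]
      refine Finset.sum_le_sum fun s _ => ?_
      simp only [hβ]
      split_ifs with hs
      · refine (Finset.sum_le_card_nsmul Finset.univ _
          (anytimeStep K (exploreRounds q (u w) s + 1)) fun i _ => ?_).trans (by simp)
        have := (hπ0 s i hs).ne'
        rw [← mul_assoc, div_mul_cancel₀ _ this]
        exact mul_le_of_le_one_right (anytimeStep_nonneg _ _) (h.mean_le_one s w i)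
      · simp
  have b2 : (∑ s ∈ Finset.range T,
      if Explores q (u w) s then (if j = act (s + 1) w then est s else 0) else 0)
      ≤ L / anytimeStep K N
        + ∑ s ∈ Finset.range T, if Explores q (u w) s then m s w j else 0 := by
    have hmin : ∀ s ∈ Finset.range T, Explores q (u w) s → min (anytimeStep K N)
        (anytimeStep K (exploreRounds q (u w) s + 1)) = anytimeStep K N := fun s hs he =>
      min_eq_left (anytimeStep_antitone (by omega)
        (exploreRounds_succ_le (Finset.mem_range.1 hs) he))
    rw [← mul_le_mul_iff_of_pos_left hηN, mul_add, mul_div_cancel₀ _ hηN.ne', Finset.mul_sum,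
      Finset.mul_sum]
    refine (Finset.sum_le_sum fun s hs => ?_).trans (hVα.trans (add_le_add_right
      (Finset.sum_le_sum fun s hs => ?_) L))
    · simp only [hα]
      split_ifs with he hj
      · rw [hest' s he, hmin s hs he]
        refine implicit_exploration_le_log (hx0 s) (hx1 s) (hπ0 s _ he) hηN.le ?_
        have := anytimeStep_antitone (K := K) (by omega)
          (exploreRounds_succ_le (Finset.mem_range.1 hs) he)
        linarith
      · simp
      · simp
    · simp only [hα]
      split_ifs with he
      · simp only [ite_mul, zero_mul, Finset.sum_ite_eq, Finset.mem_univ, if_true]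
        rw [hmin s hs he, ← mul_assoc, div_mul_cancel₀ _ (hπ0 s j he).ne']
      · simp
  have b3 := sum_loss_le q (u w) (fun s => act s w) (fun s => x s w) hK hx0 hx1 T hN j
  have b4 := regret_terms_le hK hN hL1 hL
  have b5 : (∑ s ∈ Finset.range T, if Explores q (u w) s then x (s + 1) w - m s w j else 0)
      = (∑ s ∈ Finset.range T, if Explores q (u w) s then x (s + 1) w else 0)
        - ∑ s ∈ Finset.range T, if Explores q (u w) s then m s w j else 0 := by
    rw [← Finset.sum_sub_distrib]
    exact Finset.sum_congr rfl fun s _ => by split_ifs <;> simp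
  rw [add_div] at b4
  rw [b5]
  linarith

/-- Since log 1 = 0, the step size vanishes and the potential argument is void. The regret is then
pure noise, the sum of x - m, and the same supermartingale yields its concentration. -/
theorem BanditFeedback.exists_regret_control_of_one {act : ℕ → Ω → Fin 1}
    {π m : ℕ → Ω → Fin 1 → ℝ} (h : BanditFeedback 𝓕 P act x π m) (hu : Measurable[𝓕 0] u)
    (hπ : ∀ t w, Explores q (u w) t →
      π t w = ixPolicy q (u w) (fun s => act s w) (fun s => x s w) t) (T : ℕ) :
    ∃ V : Ω → ℝ≥0∞, Measurable V ∧ ∫⁻ w, V w ∂P ≤ 1 ∧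
      ∀ᵐ w ∂P, 1 ≤ exploreRounds q (u w) T → ∀ (j : Fin 1) (L : ℝ),
        V w ≤ ENNReal.ofReal (Real.exp L) →
        (∑ s ∈ Finset.range T, if Explores q (u w) s then x (s + 1) w - m s w j else 0)
          ≤ Real.sqrt (exploreRounds q (u w) T) * (L + 1) := by
  have hut : ∀ t, Measurable[𝓕 t] u := fun t => hu.mono (𝓕.mono (Nat.zero_le t)) le_rfl
  have hex : ∀ t, MeasurableSet[𝓕 t] {w | Explores q (u w) t} := fun t =>
    @measurableSet_explores Ω q u (𝓕 t) (hut t) t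
  -- The choice l = 1/√N balances L/l against the second-order term lN; in `key` that term becomes
  -- l²N = 1.
  set l : Ω → ℝ := fun w => 1 / Real.sqrt (exploreRounds q (u w) T) with hl
  have hlm : ∀ t, Measurable[𝓕 t] l := fun t =>
    (measurable_from_top (f := fun n : ℕ => 1 / Real.sqrt n)).comp
      (@measurable_exploreRounds Ω q u (𝓕 t) (hut t) T)
  have hl0 : ∀ w, 0 ≤ l w := fun w => by positivity
  set β : ℕ → Ω → Fin 1 → ℝ := fun s w _ =>
    if Explores q (u w) s then Real.exp (l w) - 1 else 0 with hβ
  have hβm : ∀ s, Measurable[𝓕 s] (β s) := fun s =>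
    @measurable_pi_lambda _ _ _ (𝓕 s) _ _ fun i =>
      Measurable.ite (hex s) ((hlm s).exp.sub_const 1) measurable_const
  have hβ0 : ∀ s w i, 0 ≤ β s w i := fun s w i => by
    simp only [hβ]
    split_ifs
    · exact sub_nonneg.2 (Real.one_le_exp (hl0 w))
    · exact le_rfl
  refine ⟨expProduct act x π m β T, (h.adapted_expProduct hβm T).mono (𝓕.le T) le_rfl,
    h.lintegral_expProduct_le hβm hβ0 T, ?_⟩
  filter_upwards [h.obs_mem] with w hx hN j L hV
  have hj : j = 0 := Subsingleton.elim _ _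
  subst hj
  have hx0 : ∀ s, 0 ≤ x (s + 1) w := fun s => (hx s).1
  have hx1 : ∀ s, x (s + 1) w ≤ 1 := fun s => (hx s).2
  have hV' := sum_log_le_of_expProduct_le (hβ0 · w) hx0 hV
  set N := exploreRounds q (u w) T with hNdef
  have hr1 : (1 : ℝ) ≤ Real.sqrt N := by
    rw [Real.one_le_sqrt]; exact_mod_cast hN
  have hr0 : (0 : ℝ) < Real.sqrt N := by linarith
  have hlw : l w = 1 / Real.sqrt N := rfl
  have hl1 : l w ≤ 1 := by rw [hlw]; exact div_le_one_of_le₀ hr1 hr0.le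
  have hlpos : 0 < l w := by rw [hlw]; positivity
  have hexp : Real.exp (l w) - 1 ≤ l w + l w ^ 2 := by
    have h1 := (abs_le.1 (Real.abs_exp_sub_one_sub_id_le
      (abs_le.2 ⟨by linarith [hl0 w], hl1⟩))).2
    linarith
  have hlN : l w ^ 2 * N = 1 := by
    have h2 := Real.sq_sqrt (Nat.cast_nonneg (α := ℝ) N)
    rw [hlw, ← h2, Real.sqrt_sq hr0.le]
    field_simp
  have key : l w * (∑ s ∈ Finset.range T,
      if Explores q (u w) s then x (s + 1) w - m s w 0 else 0) ≤ L + 1 := by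
    have h1 : ∀ s ∈ Finset.range T,
        l w * (if Explores q (u w) s then x (s + 1) w - m s w 0 else 0)
        ≤ Real.log (1 + β s w (act (s + 1) w) * x (s + 1) w)
          - (∑ i, β s w i * (π s w i * m s w i))
          + l w ^ 2 * (if Explores q (u w) s then 1 else 0) := fun s _ => by
      simp only [hβ, Finset.univ_unique, Finset.sum_singleton]
      split_ifs with he
      · have h2 := mul_le_log_chord (l := l w) (hx0 s) (hx1 s)
        have h3 : π s w default = 1 := by
          have := sum_ixPolicy q (u w) (fun s => act s w) (fun s => x s w) s
          rw [hπ s w he]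
          simpa using this
        have h4 := h.mean_nonneg s w 0
        have h5 := h.mean_le_one s w 0
        have h6 : m s w default = m s w 0 := rfl
        rw [h3, h6]
        nlinarith [mul_le_mul_of_nonneg_right hexp h4,
          mul_le_mul_of_nonneg_left h5 (sq_nonneg (l w))]
      · simp
    rw [Finset.mul_sum]
    refine (Finset.sum_le_sum h1).trans ?_
    rw [Finset.sum_add_distrib, Finset.sum_sub_distrib, ← Finset.mul_sum,
      ← cast_exploreRounds, ← hNdef, hlN]
    linarith
  rw [hlw, one_div, inv_mul_le_iff₀ hr0] at key
  exact key

theorem BanditFeedback.exists_regret_control (h : BanditFeedback 𝓕 P act x π m)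
    (hu : Measurable[𝓕 0] u)
    (hπ : ∀ t w, Explores q (u w) t →
      π t w = ixPolicy q (u w) (fun s => act s w) (fun s => x s w) t) (T : ℕ) :
    ∃ V : Ω → ℝ≥0∞, Measurable V ∧ ∫⁻ w, V w ∂P ≤ K + 1 ∧
      ∀ᵐ w ∂P, 1 ≤ exploreRounds q (u w) T → ∀ (j : Fin K) (L : ℝ), 1 ≤ L → Real.log K ≤ L →
        V w ≤ ENNReal.ofReal (Real.exp L) →
        (∑ s ∈ Finset.range T, if Explores q (u w) s then x (s + 1) w - m s w j else 0)
          ≤ Real.sqrt (exploreRounds q (u w) T) * L * (4.21 * Real.sqrt K + 1) := by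
  rcases Nat.lt_or_ge 1 K with hK | hK
  · exact h.exists_regret_control_of_two_le hK hu hπ T
  · obtain rfl : K = 1 := le_antisymm hK (NeZero.pos K)
    obtain ⟨V, hV, hV1, hV2⟩ := h.exists_regret_control_of_one hu hπ T
    refine ⟨V, hV, hV1.trans (by simp), ?_⟩
    filter_upwards [hV2] with w hw hN j L hL1 _ hVL
    refine (hw hN j L hVL).trans ?_
    rw [mul_assoc]
    refine mul_le_mul_of_nonneg_left ?_ (Real.sqrt_nonneg _)
    simp only [Nat.cast_one, Real.sqrt_one]
    linarith

end Player

/-! ### Mean losses -/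

namespace MatrixGame

variable {A B : ℕ} (G : MatrixGame A B)

theorem ae_mem_Icc (a : Fin A) (b : Fin B) : ∀ᵐ x ∂G.lossLaw a b, x ∈ Set.Icc (0 : ℝ) 1 :=
  G.support a b

theorem integrable_loss (a : Fin A) (b : Fin B) : Integrable (fun x : ℝ => x) (G.lossLaw a b) := by
  have := G.isProb a b
  refine Integrable.of_bound measurable_id.aestronglyMeasurable 1 ?_
  filter_upwards [G.ae_mem_Icc a b] with x hx
  rw [Real.norm_eq_abs, abs_of_nonneg hx.1]
  exact hx.2

theorem lintegral_loss (a : Fin A) (b : Fin B) :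
    ∫⁻ x, ENNReal.ofReal x ∂G.lossLaw a b = ENNReal.ofReal (G.meanLoss a b) := by
  refine (ofReal_integral_eq_lintegral_ofReal (G.integrable_loss a b) ?_).symm
  filter_upwards [G.ae_mem_Icc a b] with x hx using hx.1

theorem lintegral_one_sub_loss (a : Fin A) (b : Fin B) :
    ∫⁻ x, ENNReal.ofReal (1 - x) ∂G.lossLaw a b = ENNReal.ofReal (1 - G.meanLoss a b) := by
  have := G.isProb a b
  have h1 : ∫ x, (1 - x) ∂G.lossLaw a b = 1 - G.meanLoss a b := by
    rw [integral_sub (integrable_const _) (G.integrable_loss a b)]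
    simp [meanLoss]
  rw [← h1]
  refine (ofReal_integral_eq_lintegral_ofReal
    ((integrable_const _).sub (G.integrable_loss a b)) ?_).symm
  filter_upwards [G.ae_mem_Icc a b] with x hx using sub_nonneg.2 hx.2

theorem meanLoss_nonneg (a : Fin A) (b : Fin B) : 0 ≤ G.meanLoss a b := by
  refine integral_nonneg_of_ae ?_
  filter_upwards [G.ae_mem_Icc a b] with x hx using hx.1

theorem meanLoss_le_one (a : Fin A) (b : Fin B) : G.meanLoss a b ≤ 1 := by
  have := G.isProb a b
  have h := integral_mono_ae (G.integrable_loss a b) (integrable_const (1 : ℝ))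
    (by filter_upwards [G.ae_mem_Icc a b] with x hx using hx.2)
  simpa [meanLoss] using h

end MatrixGame

/-! ### The conditional laws of actions and losses -/

/-- Two densities with the same integrals over the sets of a sub-`σ`-algebra have the same integral
against every function measurable with respect to it. -/
theorem lintegral_mul_eq_of_setLIntegral_eq {Ω : Type*} {m m0 : MeasurableSpace Ω}
    {P : Measure Ω} (hm : m ≤ m0) {f g φ : Ω → ℝ≥0∞} (hf : Measurable f) (hg : Measurable g)
    (hφ : Measurable[m] φ)
    (h : ∀ D, MeasurableSet[m] D → ∫⁻ w in D, f w ∂P = ∫⁻ w in D, g w ∂P) :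
    ∫⁻ w, φ w * f w ∂P = ∫⁻ w, φ w * g w ∂P := by
  have key : (P.withDensity f).trim hm = (P.withDensity g).trim hm := by
    refine @Measure.ext _ m _ _ fun D hD => ?_
    rw [trim_measurableSet_eq hm hD, trim_measurableSet_eq hm hD,
      withDensity_apply _ (hm D hD), withDensity_apply _ (hm D hD), h D hD]
  have hφ' : Measurable φ := hφ.mono hm le_rfl
  have h1 : ∀ {f : Ω → ℝ≥0∞}, Measurable f →
      ∫⁻ w, φ w * f w ∂P = ∫⁻ w, φ w ∂((P.withDensity f).trim hm) := fun {f} hf => by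
    rw [lintegral_trim hm hφ, lintegral_withDensity_eq_lintegral_mul P hf hφ']
    exact lintegral_congr fun w => mul_comm _ _
  rw [h1 hf, h1 hg, key]

section History

variable {A B : ℕ} {Ω W : Type*} [MeasurableSpace W] {u : Ω → W} {a : ℕ → Ω → Fin A}
  {b : ℕ → Ω → Fin B} {loss : ℕ → Ω → ℝ}

/-- The observations of the first `t` rounds together with the actions of round `t + 1`. -/
@[reducible] def actionHistory (u : Ω → W) (a : ℕ → Ω → Fin A) (b : ℕ → Ω → Fin B)
    (loss : ℕ → Ω → ℝ) (t : ℕ) : MeasurableSpace Ω :=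
  history u a b loss t ⊔ (MeasurableSpace.comap (a (t + 1)) inferInstance ⊔
    MeasurableSpace.comap (b (t + 1)) inferInstance)

theorem measurable_history_seed (t : ℕ) : Measurable[history u a b loss t] u :=
  Measurable.mono (comap_measurable u) le_sup_left le_rfl

theorem comap_round_le_history {s t : ℕ} (hst : s < t) :
    MeasurableSpace.comap (a (s + 1)) inferInstance
      ⊔ MeasurableSpace.comap (b (s + 1)) inferInstance
      ⊔ MeasurableSpace.comap (loss (s + 1)) inferInstance ≤ history u a b loss t :=
  le_sup_of_le_right (le_iSup₂_of_le (s + 1) (Finset.mem_Icc.2 ⟨by omega, hst⟩) le_rfl)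

theorem measurable_history_min {s t : ℕ} (hst : s < t) :
    Measurable[history u a b loss t] (a (s + 1)) :=
  Measurable.mono (comap_measurable (a (s + 1)))
    ((le_sup_of_le_left le_sup_left).trans (comap_round_le_history hst)) le_rfl

theorem measurable_history_max {s t : ℕ} (hst : s < t) :
    Measurable[history u a b loss t] (b (s + 1)) :=
  Measurable.mono (comap_measurable (b (s + 1)))
    ((le_sup_of_le_left le_sup_right).trans (comap_round_le_history hst)) le_rfl

theorem measurable_history_loss {s t : ℕ} (hst : s < t) :
    Measurable[history u a b loss t] (loss (s + 1)) :=
  Measurable.mono (comap_measurable (loss (s + 1)))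
    (le_sup_right.trans (comap_round_le_history hst)) le_rfl

theorem history_mono {s t : ℕ} (hst : s ≤ t) : history u a b loss s ≤ history u a b loss t :=
  sup_le_sup_left (biSup_mono fun _ hi =>
    Finset.mem_Icc.2 ⟨(Finset.mem_Icc.1 hi).1, (Finset.mem_Icc.1 hi).2.trans hst⟩) _

end History

section Play

variable {A B : ℕ} {Ω W : Type*} [m0 : MeasurableSpace Ω] [MeasurableSpace W]
  {G : MatrixGame A B} {P : Measure Ω} {u : Ω → W} {a : ℕ → Ω → Fin A} {b : ℕ → Ω → Fin B}
  {loss : ℕ → Ω → ℝ} {μ : ℕ → Ω → Fin A → ℝ} {ν : ℕ → Ω → Fin B → ℝ}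

theorem IsPlay.history_le (h : IsPlay G P u a b loss μ ν) (t : ℕ) :
    history u a b loss t ≤ m0 :=
  sup_le h.measurable_seed.comap_le (iSup₂_le fun s _ => sup_le (sup_le
    (h.measurable_min s).comap_le (h.measurable_max s).comap_le) (h.measurable_loss s).comap_le)

/-- The filtration of the observations. -/
def IsPlay.filtration (h : IsPlay G P u a b loss μ ν) : Filtration ℕ m0 where
  seq := history u a b loss
  mono' _ _ hst := history_mono hst
  le' := h.history_le

theorem measurableSet_actions (h : IsPlay G P u a b loss μ ν) (t : ℕ) (i : Fin A) (j : Fin B) :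
    MeasurableSet {w | a (t + 1) w = i ∧ b (t + 1) w = j} :=
  (h.measurable_min (t + 1) (measurableSet_singleton i)).inter
    (h.measurable_max (t + 1) (measurableSet_singleton j))

variable [IsProbabilityMeasure P]

/-- On the event that (i, j) is played, the conditional law of the loss is the fixed measure
attached to (i, j), so integrating it over a past event gives a product. -/
theorem IsPlay.measure_inter_loss (h : IsPlay G P u a b loss μ ν) (t : ℕ) (i : Fin A) (j : Fin B)
    {D : Set Ω} (hD : MeasurableSet[history u a b loss t] D) {S : Set ℝ} (hS : MeasurableSet S) :
    P (loss (t + 1) ⁻¹' S ∩ (D ∩ {w | a (t + 1) w = i ∧ b (t + 1) w = j}))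
      = P (D ∩ {w | a (t + 1) w = i ∧ b (t + 1) w = j}) * G.lossLaw i j S := by
  set C := D ∩ {w | a (t + 1) w = i ∧ b (t + 1) w = j} with hC
  have hle : actionHistory u a b loss t ≤ m0 := sup_le (h.history_le t)
    (sup_le (h.measurable_min _).comap_le (h.measurable_max _).comap_le)
  have e1 : history u a b loss t ≤ actionHistory u a b loss t := le_sup_left
  have e2 : MeasurableSpace.comap (a (t + 1)) inferInstance ≤ actionHistory u a b loss t :=
    le_sup_left.trans le_sup_right
  have e3 : MeasurableSpace.comap (b (t + 1)) inferInstance ≤ actionHistory u a b loss t :=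
    le_sup_right.trans le_sup_right
  have hCm : MeasurableSet[actionHistory u a b loss t] C :=
    MeasurableSet.inter (e1 _ hD) (MeasurableSet.inter
      (e2 _ ⟨{i}, measurableSet_singleton i, rfl⟩) (e3 _ ⟨{j}, measurableSet_singleton j, rfl⟩))
  have hSm : MeasurableSet (loss (t + 1) ⁻¹' S) := h.measurable_loss _ hS
  have hpr := G.isProb i j
  have h1 := setIntegral_condExp (μ := P) hle
    ((integrable_const (1 : ℝ)).indicator hSm) hCm
  rw [setIntegral_congr_ae (hle _ hCm) ((h.loss_law t S hS).mono fun w hw _ => hw),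
    setIntegral_congr_fun (hle _ hCm) (g := fun _ => (G.lossLaw i j).real S)
      (fun w hw => by simp only [hw.2.1, hw.2.2])] at h1
  rw [setIntegral_const, integral_indicator hSm, Measure.restrict_restrict hSm, setIntegral_const,
    smul_eq_mul, smul_eq_mul, mul_one, measureReal_def, measureReal_def, measureReal_def,
    ← ENNReal.toReal_mul] at h1
  exact ((ENNReal.toReal_eq_toReal_iff' (ENNReal.mul_ne_top (measure_ne_top _ _)
    (measure_ne_top _ _)) (measure_ne_top _ _)).1 h1).symm

theorem IsPlay.setLIntegral_loss (h : IsPlay G P u a b loss μ ν) (t : ℕ) (i : Fin A) (j : Fin B)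
    {D : Set Ω} (hD : MeasurableSet[history u a b loss t] D) {g : ℝ → ℝ≥0∞} (hg : Measurable g) :
    ∫⁻ w in D ∩ {w | a (t + 1) w = i ∧ b (t + 1) w = j}, g (loss (t + 1) w) ∂P
      = P (D ∩ {w | a (t + 1) w = i ∧ b (t + 1) w = j}) * ∫⁻ x, g x ∂G.lossLaw i j := by
  have key : (P.restrict (D ∩ {w | a (t + 1) w = i ∧ b (t + 1) w = j})).map (loss (t + 1))
      = P (D ∩ {w | a (t + 1) w = i ∧ b (t + 1) w = j}) • G.lossLaw i j := by
    ext S hS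
    rw [Measure.map_apply (h.measurable_loss _) hS,
      Measure.restrict_apply (h.measurable_loss _ hS), h.measure_inter_loss t i j hD hS]
    rfl
  rw [← lintegral_map hg (h.measurable_loss _), key, lintegral_smul_measure, smul_eq_mul]

theorem IsPlay.measure_inter_actions (h : IsPlay G P u a b loss μ ν)
    (hl : IsLearningSequence u a b loss μ ν) (t : ℕ) (i : Fin A) (j : Fin B)
    {D : Set Ω} (hD : MeasurableSet[history u a b loss t] D) :
    P (D ∩ {w | a (t + 1) w = i ∧ b (t + 1) w = j})
      = ∫⁻ w in D, ENNReal.ofReal (μ (t + 1) w i * ν (t + 1) w j) ∂P := by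
  have hle := h.history_le t
  have hE := measurableSet_actions h t i j
  have h1 := setIntegral_condExp (μ := P) hle ((integrable_const (1 : ℝ)).indicator hE) hD
  have hint : IntegrableOn (fun w => μ (t + 1) w i * ν (t + 1) w j) D P :=
    (integrable_condExp.congr (h.action_law t i j)).integrableOn
  rw [setIntegral_congr_ae (hle _ hD) ((h.action_law t i j).mono fun w hw _ => hw),
    integral_indicator hE, Measure.restrict_restrict hE, setIntegral_const, smul_eq_mul, mul_one,
    Set.inter_comm, measureReal_def] at h1
  rw [← ofReal_integral_eq_lintegral_ofReal hint
    (ae_of_all _ fun w => mul_nonneg ((hl t).1 w |>.1 i) ((hl t).2.1 w |>.1 j)), h1,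
    ENNReal.ofReal_toReal (measure_ne_top _ _)]

/-- The complete law of one round in integrated form. Past events are handled by the two conditional
laws; arbitrary nonnegative functions of the past follow from them. -/
theorem IsPlay.lintegral_mul_actions (h : IsPlay G P u a b loss μ ν)
    (hl : IsLearningSequence u a b loss μ ν) (t : ℕ) (i : Fin A) (j : Fin B)
    {g : ℝ → ℝ≥0∞} (hg : Measurable g) {φ : Ω → ℝ≥0∞} (hφ : Measurable[history u a b loss t] φ) :
    ∫⁻ w, φ w * (if a (t + 1) w = i ∧ b (t + 1) w = j then g (loss (t + 1) w) else 0) ∂P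
      = ∫⁻ w, φ w * (ENNReal.ofReal (μ (t + 1) w i * ν (t + 1) w j)
          * ∫⁻ x, g x ∂G.lossLaw i j) ∂P := by
  have hle := h.history_le t
  have hE := measurableSet_actions h t i j
  have hμ : Measurable fun w => ENNReal.ofReal (μ (t + 1) w i * ν (t + 1) w j) :=
    (((measurable_pi_apply i).comp ((hl t).2.2.1.mono hle le_rfl)).mul
      ((measurable_pi_apply j).comp ((hl t).2.2.2.mono hle le_rfl))).ennreal_ofReal
  refine lintegral_mul_eq_of_setLIntegral_eq hle
    (Measurable.ite hE (hg.comp (h.measurable_loss _)) measurable_const)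
    (hμ.mul_const _) hφ fun D hD => ?_
  rw [lintegral_mul_const _ hμ, ← h.measure_inter_actions hl t i j hD,
    ← h.setLIntegral_loss t i j hD hg, Set.inter_comm, ← Measure.restrict_restrict hE,
    ← lintegral_indicator hE]
  exact lintegral_congr fun w => by simp [Set.indicator_apply]

theorem IsPlay.ae_loss_mem (h : IsPlay G P u a b loss μ ν) :
    ∀ᵐ w ∂P, ∀ t, loss (t + 1) w ∈ Set.Icc (0 : ℝ) 1 := by
  refine ae_all_iff.2 fun t => ?_
  have h1 : ∀ i j, P (loss (t + 1) ⁻¹' (Set.Icc (0 : ℝ) 1)ᶜ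
      ∩ {w | a (t + 1) w = i ∧ b (t + 1) w = j}) = 0 := fun i j => by
    have := h.measure_inter_loss t i j MeasurableSet.univ
      (measurableSet_Icc (a := (0 : ℝ)) (b := 1)).compl
    rwa [Set.univ_inter, G.support, mul_zero] at this
  refine measure_mono_null (fun w hw => ?_)
    (measure_iUnion_null fun i => measure_iUnion_null fun j => h1 i j)
  exact Set.mem_iUnion.2 ⟨a (t + 1) w, Set.mem_iUnion.2 ⟨b (t + 1) w, hw, rfl, rfl⟩⟩

/-- The policy of the opponent is predictable, so averaging the game over it turns the opponent into
an adversary whose mean losses are fixed before the action is drawn. -/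
theorem IsPlay.feedback_min (h : IsPlay G P u a b loss μ ν)
    (hl : IsLearningSequence u a b loss μ ν) :
    BanditFeedback h.filtration P a loss (fun t => μ (t + 1))
      (fun t w i => ∑ j, ν (t + 1) w j * G.meanLoss i j) where
  measurable_act _ := measurable_history_min (Nat.lt_succ_self _)
  measurable_obs _ := measurable_history_loss (Nat.lt_succ_self _)
  measurable_policy t := (hl t).2.2.1
  measurable_mean t := @measurable_pi_lambda _ _ _ (history u a b loss t) _ _ fun i =>
    Finset.measurable_sum _ fun j _ => ((measurable_pi_apply j).comp (hl t).2.2.2).mul_const _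
  policy_nonneg t w i := (hl t).1 w |>.1 i
  mean_nonneg t w i := Finset.sum_nonneg fun j _ =>
    mul_nonneg ((hl t).2.1 w |>.1 j) (G.meanLoss_nonneg i j)
  mean_le_one t w i := by
    refine (Finset.sum_le_sum fun j _ => ?_).trans ((hl t).2.1 w).2.le
    exact mul_le_of_le_one_right ((hl t).2.1 w |>.1 j) (G.meanLoss_le_one i j)
  obs_mem := h.ae_loss_mem
  sampling t i φ hφ := by
    have hle := h.history_le t
    have hφ' : Measurable φ := hφ.mono hle le_rfl
    have hμ : ∀ j, Measurable fun w => ENNReal.ofReal (μ (t + 1) w i * ν (t + 1) w j) := fun j =>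
      (((measurable_pi_apply i).comp ((hl t).2.2.1.mono hle le_rfl)).mul
        ((measurable_pi_apply j).comp ((hl t).2.2.2.mono hle le_rfl))).ennreal_ofReal
    calc _ = ∑ j, ∫⁻ w, φ w * (if a (t + 1) w = i ∧ b (t + 1) w = j then
          ENNReal.ofReal (loss (t + 1) w) else 0) ∂P := by
          rw [← lintegral_finsetSum]
          · refine lintegral_congr fun w => ?_
            rw [← Finset.mul_sum]
            congr 1
            by_cases hi : a (t + 1) w = i <;> simp [hi]
          · exact fun j _ => hφ'.mul (Measurable.ite (measurableSet_actions h t i j)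
              (h.measurable_loss _).ennreal_ofReal measurable_const)
      _ = ∑ j, ∫⁻ w, φ w * (ENNReal.ofReal (μ (t + 1) w i * ν (t + 1) w j)
          * ENNReal.ofReal (G.meanLoss i j)) ∂P := by
          refine Finset.sum_congr rfl fun j _ => ?_
          rw [h.lintegral_mul_actions hl t i j ENNReal.measurable_ofReal hφ, G.lintegral_loss]
      _ = _ := by
          rw [← lintegral_finsetSum _ fun j _ => by exact hφ'.mul ((hμ j).mul_const _)]
          refine lintegral_congr fun w => ?_
          rw [← Finset.mul_sum]
          congr 1
          rw [Finset.mul_sum]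
          have h0 := fun j => mul_nonneg ((hl t).1 w |>.1 i) ((hl t).2.1 w |>.1 j)
          rw [ENNReal.ofReal_sum_of_nonneg fun j _ => by
            rw [← mul_assoc]; exact mul_nonneg (h0 j) (G.meanLoss_nonneg i j)]
          exact Finset.sum_congr rfl fun j _ => by
            rw [← mul_assoc, ENNReal.ofReal_mul (h0 j)]

theorem IsPlay.feedback_max (h : IsPlay G P u a b loss μ ν)
    (hl : IsLearningSequence u a b loss μ ν) :
    BanditFeedback h.filtration P b (fun t w => 1 - loss t w) (fun t => ν (t + 1))
      (fun t w j => ∑ i, μ (t + 1) w i * (1 - G.meanLoss i j)) where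
  measurable_act _ := measurable_history_max (Nat.lt_succ_self _)
  measurable_obs _ := (measurable_history_loss (Nat.lt_succ_self _)).const_sub 1
  measurable_policy t := (hl t).2.2.2
  measurable_mean t := @measurable_pi_lambda _ _ _ (history u a b loss t) _ _ fun j =>
    Finset.measurable_sum _ fun i _ => ((measurable_pi_apply i).comp (hl t).2.2.1).mul_const _
  policy_nonneg t w i := (hl t).2.1 w |>.1 i
  mean_nonneg t w j := Finset.sum_nonneg fun i _ =>
    mul_nonneg ((hl t).1 w |>.1 i) (sub_nonneg.2 (G.meanLoss_le_one i j))
  mean_le_one t w j := by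
    refine (Finset.sum_le_sum fun i _ => ?_).trans ((hl t).1 w).2.le
    exact mul_le_of_le_one_right ((hl t).1 w |>.1 i) (sub_le_self _ (G.meanLoss_nonneg i j))
  obs_mem := h.ae_loss_mem.mono fun w hw t =>
    ⟨sub_nonneg.2 (hw t).2, sub_le_self _ (hw t).1⟩
  sampling t j φ hφ := by
    have hle := h.history_le t
    have hφ' : Measurable φ := hφ.mono hle le_rfl
    have hμ : ∀ i, Measurable fun w => ENNReal.ofReal (μ (t + 1) w i * ν (t + 1) w j) := fun i =>
      (((measurable_pi_apply i).comp ((hl t).2.2.1.mono hle le_rfl)).mul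
        ((measurable_pi_apply j).comp ((hl t).2.2.2.mono hle le_rfl))).ennreal_ofReal
    calc _ = ∑ i, ∫⁻ w, φ w * (if a (t + 1) w = i ∧ b (t + 1) w = j then
          ENNReal.ofReal (1 - loss (t + 1) w) else 0) ∂P := by
          rw [← lintegral_finsetSum]
          · refine lintegral_congr fun w => ?_
            rw [← Finset.mul_sum]
            congr 1
            by_cases hj : b (t + 1) w = j <;> simp [hj]
          · exact fun i _ => hφ'.mul (Measurable.ite (measurableSet_actions h t i j)
              ((h.measurable_loss _).const_sub 1).ennreal_ofReal measurable_const)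
      _ = ∑ i, ∫⁻ w, φ w * (ENNReal.ofReal (μ (t + 1) w i * ν (t + 1) w j)
          * ENNReal.ofReal (1 - G.meanLoss i j)) ∂P := by
          refine Finset.sum_congr rfl fun i _ => ?_
          rw [h.lintegral_mul_actions hl t i j (g := fun y => ENNReal.ofReal (1 - y))
            (measurable_id.const_sub 1).ennreal_ofReal hφ, G.lintegral_one_sub_loss]
      _ = _ := by
          rw [← lintegral_finsetSum _ fun i _ => by exact hφ'.mul ((hμ i).mul_const _)]
          refine lintegral_congr fun w => ?_
          rw [← Finset.mul_sum]
          congr 1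
          rw [Finset.mul_sum]
          have h0 := fun i => mul_nonneg ((hl t).1 w |>.1 i) ((hl t).2.1 w |>.1 j)
          have h1 : ∀ i, ν (t + 1) w j * (μ (t + 1) w i * (1 - G.meanLoss i j))
              = μ (t + 1) w i * ν (t + 1) w j * (1 - G.meanLoss i j) := fun i => by ring
          simp only [h1]
          rw [ENNReal.ofReal_sum_of_nonneg fun i _ =>
            mul_nonneg (h0 i) (sub_nonneg.2 (G.meanLoss_le_one i j))]
          exact Finset.sum_congr rfl fun i _ => (ENNReal.ofReal_mul (h0 i)).symm

end Play

/-! ### The exploitability gap -/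

theorem sum_mul_le_of_mem_stdSimplex {K : ℕ} {w f : Fin K → ℝ} {c : ℝ}
    (hw : w ∈ stdSimplex ℝ (Fin K)) (hf : ∀ i, f i ≤ c) : ∑ i, w i * f i ≤ c :=
  calc ∑ i, w i * f i ≤ ∑ i, w i * c :=
        Finset.sum_le_sum fun i _ => mul_le_mul_of_nonneg_left (hf i) (hw.1 i)
    _ = c := by rw [← Finset.sum_mul, hw.2, one_mul]

namespace MatrixGame

variable {A B : ℕ} (G : MatrixGame A B)

theorem expLoss_eq_sum_min (μ : Fin A → ℝ) (ν : Fin B → ℝ) :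
    G.expLoss μ ν = ∑ i, μ i * ∑ j, ν j * G.meanLoss i j := by
  simp only [expLoss, Finset.mul_sum, mul_assoc]

theorem expLoss_eq_sum_max {μ : Fin A → ℝ} (hμ : μ ∈ stdSimplex ℝ (Fin A)) (ν : Fin B → ℝ) :
    G.expLoss μ ν = ∑ j, ν j * (1 - ∑ i, μ i * (1 - G.meanLoss i j)) := by
  rw [expLoss, Finset.sum_comm]
  refine Finset.sum_congr rfl fun j _ => ?_
  simp only [mul_sub, mul_one, Finset.sum_sub_distrib, hμ.2, sub_sub_cancel, Finset.mul_sum]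
  exact Finset.sum_congr rfl fun i _ => by ring

theorem expLoss_nonneg {μ : Fin A → ℝ} {ν : Fin B → ℝ} (hμ : μ ∈ stdSimplex ℝ (Fin A))
    (hν : ν ∈ stdSimplex ℝ (Fin B)) : 0 ≤ G.expLoss μ ν :=
  Finset.sum_nonneg fun i _ => Finset.sum_nonneg fun j _ =>
    mul_nonneg (mul_nonneg (hμ.1 i) (hν.1 j)) (G.meanLoss_nonneg i j)

theorem expLoss_le_one {μ : Fin A → ℝ} {ν : Fin B → ℝ} (hμ : μ ∈ stdSimplex ℝ (Fin A))
    (hν : ν ∈ stdSimplex ℝ (Fin B)) : G.expLoss μ ν ≤ 1 := by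
  rw [expLoss_eq_sum_min]
  exact sum_mul_le_of_mem_stdSimplex hμ fun i =>
    sum_mul_le_of_mem_stdSimplex hν fun j => G.meanLoss_le_one i j

variable {μ : Fin A → ℝ} {ν : Fin B → ℝ}

theorem exploitabilityGap_nonneg (hμ : μ ∈ stdSimplex ℝ (Fin A))
    (hν : ν ∈ stdSimplex ℝ (Fin B)) : 0 ≤ G.exploitabilityGap μ ν := by
  have h1 : G.expLoss μ ν ≤ sSup ((fun ν' => G.expLoss μ ν') '' stdSimplex ℝ (Fin B)) := by
    refine le_csSup ⟨1, ?_⟩ ⟨ν, hν, rfl⟩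
    rintro _ ⟨ν', hν', rfl⟩
    exact G.expLoss_le_one hμ hν'
  have h2 : sInf ((fun μ' => G.expLoss μ' ν) '' stdSimplex ℝ (Fin A)) ≤ G.expLoss μ ν := by
    refine csInf_le ⟨0, ?_⟩ ⟨μ, hμ, rfl⟩
    rintro _ ⟨μ', hμ', rfl⟩
    exact G.expLoss_nonneg hμ' hν
  exact sub_nonneg.2 (h2.trans h1)

/-- It suffices to bound the gap against pure deviations. -/
theorem exploitabilityGap_le (hμ : μ ∈ stdSimplex ℝ (Fin A)) (hν : ν ∈ stdSimplex ℝ (Fin B))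
    {c : ℝ} (h : ∀ i j, 1 - (∑ i', μ i' * (1 - G.meanLoss i' j))
      - (∑ j', ν j' * G.meanLoss i j') ≤ c) : G.exploitabilityGap μ ν ≤ c := by
  refine sub_le_iff_le_add.2 (csSup_le ⟨_, ν, hν, rfl⟩ ?_)
  rintro _ ⟨ν', hν', rfl⟩
  rw [← sub_le_iff_le_add']
  refine le_csInf ⟨_, μ, hμ, rfl⟩ ?_
  rintro _ ⟨μ', hμ', rfl⟩
  dsimp only
  rw [expLoss_eq_sum_max G hμ, expLoss_eq_sum_min G μ']
  have h1 : ∀ i, -(∑ j', ν j' * G.meanLoss i j')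
      ≤ c - ∑ j, ν' j * (1 - ∑ i, μ i * (1 - G.meanLoss i j)) := fun i => by
    have := sum_mul_le_of_mem_stdSimplex hν' fun j => sub_le_iff_le_add.1 (h i j)
    linarith
  have h2 := sum_mul_le_of_mem_stdSimplex hμ' h1
  simp only [mul_neg, Finset.sum_neg_distrib] at h2
  linarith

theorem exploitabilityGap_le_one (hμ : μ ∈ stdSimplex ℝ (Fin A))
    (hν : ν ∈ stdSimplex ℝ (Fin B)) : G.exploitabilityGap μ ν ≤ 1 := by
  refine G.exploitabilityGap_le hμ hν fun i j => ?_
  have h1 : 0 ≤ ∑ i', μ i' * (1 - G.meanLoss i' j) := Finset.sum_nonneg fun i' _ =>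
    mul_nonneg (hμ.1 i') (sub_nonneg.2 (G.meanLoss_le_one i' j))
  have h2 : 0 ≤ ∑ j', ν j' * G.meanLoss i j' := Finset.sum_nonneg fun j' _ =>
    mul_nonneg (hν.1 j') (G.meanLoss_nonneg i j')
  linarith

end MatrixGame

/-- In an exploiting round the played policy is the average of the exploring policies. -/
theorem sum_eoePolicy_mul_of_not_explores {K : ℕ} {q : ℕ → ℝ} {v : ℝ} {act : ℕ → Fin K}
    {x : ℕ → ℝ} {t : ℕ} (h : ¬Explores q v t) (c : Fin K → ℝ) :
    ∑ i, eoePolicy (anytimeExp3IX K) q v act x (t + 1) i * c i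
      = (∑ s ∈ Finset.range t, if Explores q v s then
          ∑ i, eoePolicy (anytimeExp3IX K) q v act x (s + 1) i * c i else 0)
        / exploreRounds q v t := by
  rw [eoePolicy_succ, if_neg h]
  simp only [div_mul_eq_mul_div, ← Finset.sum_div, Finset.sum_mul]
  rw [Finset.sum_comm]
  congr 1
  refine Finset.sum_congr rfl fun s _ => ?_
  split_ifs with hs
  · rw [eoePolicy_succ, if_pos hs]
  · simp

/-- The gap of the averages is bounded by the sum of the two regrets, because the observed losses
of the two players add up to one. -/
theorem exploitabilityGap_le_regret {A B : ℕ} [NeZero A] [NeZero B] (G : MatrixGame A B)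
    {q : ℕ → ℝ} {v : ℝ} {a : ℕ → Fin A} {b : ℕ → Fin B} {loss : ℕ → ℝ} {t : ℕ}
    (ht : ¬Explores q v t) (hn : 1 ≤ exploreRounds q v t) {R R' : ℝ}
    {μ : ℕ → Fin A → ℝ} {ν : ℕ → Fin B → ℝ}
    (hμ : ∀ s, μ s = eoePolicy (anytimeExp3IX A) q v a loss s)
    (hν : ∀ s, ν s = eoePolicy (anytimeExp3IX B) q v b (fun s => 1 - loss s) s)
    (hR : ∀ i, (∑ s ∈ Finset.range t, if Explores q v s then
      loss (s + 1) - ∑ j, ν (s + 1) j * G.meanLoss i j else 0) ≤ R)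
    (hR' : ∀ j, (∑ s ∈ Finset.range t, if Explores q v s then
      1 - loss (s + 1) - ∑ i, μ (s + 1) i * (1 - G.meanLoss i j) else 0) ≤ R') :
    G.exploitabilityGap (μ (t + 1)) (ν (t + 1)) ≤ (R + R') / exploreRounds q v t := by
  have hn0 : (0 : ℝ) < exploreRounds q v t := by exact_mod_cast hn
  refine G.exploitabilityGap_le (by rw [hμ]; exact eoePolicy_mem _ _ _ (Or.inr hn))
    (by rw [hν]; exact eoePolicy_mem _ _ _ (Or.inr hn)) fun i j => ?_
  simp only [hμ, hν] at hR hR' ⊢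
  rw [sum_eoePolicy_mul_of_not_explores ht, sum_eoePolicy_mul_of_not_explores ht,
    le_div_iff₀ hn0, sub_mul, sub_mul, div_mul_cancel₀ _ hn0.ne', div_mul_cancel₀ _ hn0.ne',
    one_mul]
  refine le_trans (le_of_eq ?_) (add_le_add (hR i) (hR' j))
  rw [cast_exploreRounds, ← Finset.sum_sub_distrib, ← Finset.sum_sub_distrib,
    ← Finset.sum_add_distrib]
  refine Finset.sum_congr rfl fun s _ => ?_
  split_ifs
  · ring
  · ring

/-! ### The exploration probabilities -/

/-- Adding q crosses an integer exactly when v lies in an interval of length q modulo 1, so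
uniformity of v gives probability q. -/
theorem volume_floor_lt_floor_le {S q : ℝ} (hS : 0 ≤ S) (hq0 : 0 ≤ q) (hq1 : q ≤ 1) :
    volume {v : unitInterval | ⌊S + v⌋₊ < ⌊S + q + v⌋₊} ≤ ENNReal.ofReal q := by
  rw [unitInterval.volume_apply]
  have hf0 := Int.fract_nonneg S
  have hf1 := Int.fract_lt_one S
  have hfS := Int.floor_add_fract S
  set f := Int.fract S with hf
  have hsub : ∀ y ∈ Subtype.val '' {v : unitInterval | ⌊S + v⌋₊ < ⌊S + q + v⌋₊},
      (0 ≤ y ∧ y ≤ 1) ∧ ((1 - f - q ≤ y ∧ y < 1 - f) ∨ (2 - f - q ≤ y ∧ y < 2 - f)) := by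
    rintro _ ⟨v, hv, rfl⟩
    have hv0 := v.2.1
    have hv1 := v.2.2
    have h1 : ((⌊S + q + v⌋₊ : ℕ) : ℝ) ≤ S + q + v := Nat.floor_le (by positivity)
    have h2 : S + v < (⌊S + q + v⌋₊ : ℕ) := (Nat.floor_lt (by positivity)).1 hv
    refine ⟨⟨hv0, hv1⟩, ?_⟩
    generalize ⌊S + q + v⌋₊ = n at h1 h2
    -- The integer crossed exceeds ⌊S⌋ by k = 1 or k = 2. If f + q ≤ 1, then k = 2 is possible only
    -- at the null point v = 1; otherwise the two pieces have total length (1 - f) + (f + q - 1) =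
    -- q.
    obtain ⟨k, hk⟩ : ∃ k : ℤ, k = (n : ℤ) - ⌊S⌋ := ⟨_, rfl⟩
    have hk' : (k : ℝ) = n - ⌊S⌋ := by rw [hk]; push_cast; ring
    have hk0 : (0 : ℝ) < k := by linarith
    have hk3 : (k : ℝ) < 3 := by linarith
    have hk0' : 0 < k := by exact_mod_cast hk0
    have hk3' : k < 3 := by exact_mod_cast hk3
    obtain rfl | rfl : k = 1 ∨ k = 2 := by omega
    · left; push_cast at hk'; constructor <;> linarith
    · right; push_cast at hk'; constructor <;> linarith
  rcases le_total (f + q) 1 with h | h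
  · calc _ ≤ volume (Set.Ico (1 - f - q) (1 - f) ∪ {1}) := by
          refine measure_mono fun y hy => ?_
          obtain ⟨⟨h0, h1⟩, h2 | h2⟩ := hsub y hy
          · exact Or.inl h2
          · exact Or.inr (le_antisymm h1 (by linarith [h2.1]))
      _ ≤ volume (Set.Ico (1 - f - q) (1 - f)) + volume {(1 : ℝ)} := measure_union_le _ _
      _ = ENNReal.ofReal q := by simp
  · calc _ ≤ volume (Set.Icc 0 (1 - f) ∪ Set.Icc (2 - f - q) 1) := by
          refine measure_mono fun y hy => ?_
          obtain ⟨⟨h0, h1⟩, h2 | h2⟩ := hsub y hy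
          · exact Or.inl ⟨h0, h2.2.le⟩
          · exact Or.inr ⟨h2.1, h1⟩
      _ ≤ volume (Set.Icc 0 (1 - f)) + volume (Set.Icc (2 - f - q) 1) := measure_union_le _ _
      _ = ENNReal.ofReal q := by
          rw [Real.volume_Icc, Real.volume_Icc, ← ENNReal.ofReal_add (by linarith) (by linarith)]
          congr 1; ring

theorem measure_explores_le {Ω : Type*} [MeasurableSpace Ω] {P : Measure Ω}
    [IsProbabilityMeasure P] {u : Ω → unitInterval} (hu : Measurable u) (hmap : P.map u = volume)
    {q : ℕ → ℝ} (hq0 : ∀ t, 0 ≤ q t) (hq1 : ∀ t, q t ≤ 1) (hq : q 1 = 1) (t : ℕ) :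
    P {w | Explores q (u w) t} ≤ ENNReal.ofReal (q (t + 1)) := by
  rcases t with _ | t
  -- Round 1 is separate because the counter at time 0 is 0 and not ⌊u⌋.
  · rw [zero_add, hq, ENNReal.ofReal_one]; exact prob_le_one
  · have hset : MeasurableSet {v : unitInterval | Explores q v (t + 1)} :=
      measurableSet_explores (u := id) measurable_id (t + 1)
    have h1 : P {w | Explores q (u w) (t + 1)}
        = P.map u {v : unitInterval | Explores q v (t + 1)} := by
      rw [Measure.map_apply hu hset]; rfl
    rw [h1, hmap]
    simp only [Explores, exploreCount]
    rw [Finset.sum_Icc_succ_top (by omega : 1 ≤ t + 1 + 1)]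
    exact volume_floor_lt_floor_le (Finset.sum_nonneg fun i _ => hq0 i) (hq0 _) (hq1 _)

section ExploreProb

variable {p : ℝ}

theorem exploreProb_nonneg (p : ℝ) (t : ℕ) : 0 ≤ exploreProb p t :=
  Real.rpow_nonneg (Nat.cast_nonneg t) _

theorem exploreProb_le_one (hp : 0 < p) (t : ℕ) : exploreProb p t ≤ 1 := by
  have hα : 0 < p / (2 + p) := by positivity
  rcases Nat.eq_zero_or_pos t with rfl | ht
  · rw [exploreProb, Nat.cast_zero, Real.zero_rpow (by linarith)]; exact zero_le_one
  · exact Real.rpow_le_one_of_one_le_of_nonpos (by exact_mod_cast ht) (by linarith)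

theorem exploreProb_one (p : ℝ) : exploreProb p 1 = 1 := by
  simp [exploreProb]

theorem one_le_sum_exploreProb {t : ℕ} (ht : 1 ≤ t) :
    1 ≤ ∑ i ∈ Finset.Icc 1 t, exploreProb p i := by
  rw [← exploreProb_one p]
  exact Finset.single_le_sum (f := exploreProb p) (fun i _ => exploreProb_nonneg p i)
    (Finset.mem_Icc.2 ⟨le_rfl, ht⟩)

/-- The probabilities decrease, so the sum is at least t times the next one, and t + 1 ≤ 2t. -/
theorem rpow_le_sum_exploreProb (hp : 0 < p) {t : ℕ} (ht : 1 ≤ t) :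
    ((t + 1 : ℕ) : ℝ) ^ (2 / (2 + p)) ≤ 2 * ∑ i ∈ Finset.Icc 1 t, exploreProb p i := by
  have hα : 0 < p / (2 + p) := by positivity
  have hT : (0 : ℝ) < ((t + 1 : ℕ) : ℝ) := by positivity
  have h1 : (t : ℝ) * exploreProb p (t + 1) ≤ ∑ i ∈ Finset.Icc 1 t, exploreProb p i := by
    have := Finset.card_nsmul_le_sum (Finset.Icc 1 t) (exploreProb p) (exploreProb p (t + 1))
      fun i hi => by
        obtain ⟨h1, h2⟩ := Finset.mem_Icc.1 hi
        exact Real.rpow_le_rpow_of_nonpos (by exact_mod_cast h1) (by exact_mod_cast h2.step)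
          (by linarith)
    simpa using this
  have h2 : ((t + 1 : ℕ) : ℝ) ^ (2 / (2 + p)) = ((t + 1 : ℕ) : ℝ) * exploreProb p (t + 1) := by
    rw [exploreProb, ← Real.rpow_one_add' hT.le]
    · congr 1; field_simp; ring
    · have : 1 + -(p / (2 + p)) = 2 / (2 + p) := by field_simp; ring
      rw [this]; positivity
  have h3 : ((t + 1 : ℕ) : ℝ) ≤ 2 * t := by exact_mod_cast (by omega : t + 1 ≤ 2 * t)
  rw [h2]
  nlinarith [mul_le_mul_of_nonneg_right h3 (exploreProb_nonneg p (t + 1))]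

theorem one_le_exploreRounds (hp : 0 < p) (v : unitInterval) {t : ℕ} (ht : 1 ≤ t) :
    1 ≤ exploreRounds (exploreProb p) v t :=
  le_trans (Nat.le_floor (by rw [Nat.cast_one]; exact one_le_sum_exploreProb ht))
    (floor_sum_le_exploreRounds (exploreProb_nonneg p) (exploreProb_le_one hp)
      (exploreProb_one p) v.2.1 t)

theorem explores_zero (p : ℝ) (v : unitInterval) : Explores (exploreProb p) v 0 := by
  simp only [Explores, exploreCount, zero_add, Finset.Icc_self, Finset.sum_singleton,
    exploreProb_one]
  exact Nat.floor_pos.2 (by linarith [v.2.1])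

/-- The sum Σ of the probabilities satisfies Σ < N + 1 ≤ 2N, so the square of the left side is at
most 2Σ ≤ 4N. -/
theorem rpow_le_sqrt_exploreRounds (hp : 0 < p) (v : unitInterval) {t : ℕ} (ht : 1 ≤ t) :
    ((t + 1 : ℕ) : ℝ) ^ (1 / (2 + p)) ≤ 2 * Real.sqrt (exploreRounds (exploreProb p) v t) := by
  have h1 := floor_sum_le_exploreRounds (exploreProb_nonneg p) (exploreProb_le_one hp)
      (exploreProb_one p) v.2.1 t
  have h2 := rpow_le_sum_exploreProb hp ht
  have h3 := Nat.lt_floor_add_one (∑ i ∈ Finset.Icc 1 t, exploreProb p i)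
  have h4 : (1 : ℝ) ≤ exploreRounds (exploreProb p) v t := by
    exact_mod_cast one_le_exploreRounds hp v ht
  have h5 : ((⌊∑ i ∈ Finset.Icc 1 t, exploreProb p i⌋₊ : ℕ) : ℝ)
      ≤ exploreRounds (exploreProb p) v t := by exact_mod_cast h1
  have hT : (0 : ℝ) ≤ ((t + 1 : ℕ) : ℝ) := by positivity
  have h6 : (((t + 1 : ℕ) : ℝ) ^ (1 / (2 + p))) ^ 2 = ((t + 1 : ℕ) : ℝ) ^ (2 / (2 + p)) := by
    rw [← Real.rpow_natCast, ← Real.rpow_mul hT]; congr 1; push_cast; ring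
  refine le_of_sq_le_sq ?_ (by positivity)
  rw [h6, mul_pow, Real.sq_sqrt (by positivity)]
  linarith

end ExploreProb

/-! ### The rate -/

/-- In the variable X = Ct² the rate is a multiple of log X / X^(r/2), whose monotonicity and limit
are standard. -/
theorem rate_eq {C r c : ℝ} (hC : 0 < C) {t : ℕ} (ht : 1 ≤ t) :
    c * (t : ℝ) ^ (-r) * Real.log (C * (t : ℝ) ^ 2)
      = c * C ^ (r / 2) * (Real.log (C * (t : ℝ) ^ 2) / (C * (t : ℝ) ^ 2) ^ (r / 2)) := by
  have ht0 : (0 : ℝ) < t := by exact_mod_cast ht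
  have h1 : (C * (t : ℝ) ^ 2) ^ (r / 2) = C ^ (r / 2) * (t : ℝ) ^ r := by
    rw [Real.mul_rpow hC.le (by positivity), ← Real.rpow_natCast, ← Real.rpow_mul ht0.le]
    congr 2; push_cast; ring
  rw [h1, Real.rpow_neg ht0.le]
  field_simp

theorem rate_antitoneOn {C r c : ℝ} (hC : 1 ≤ C) (hr : 0 < r) (hc : 0 ≤ c) :
    ∃ t₀ : ℕ, AntitoneOn (fun t : ℕ => c * (t : ℝ) ^ (-r) * Real.log (C * (t : ℝ) ^ 2))
      (Set.Ici t₀) := by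
  -- The quotient log X / X^a decreases from X = exp(1/a) on, here with a = r/2.
  refine ⟨⌈Real.exp (r / 2)⁻¹⌉₊ + 1, fun s hs t ht hst => ?_⟩
  have hC0 : 0 < C := by linarith
  have key : ∀ t : ℕ, ⌈Real.exp (r / 2)⁻¹⌉₊ + 1 ≤ t →
      Real.exp (r / 2)⁻¹ ≤ C * (t : ℝ) ^ 2 := fun t ht => by
    have h1 : (⌈Real.exp (r / 2)⁻¹⌉₊ : ℝ) + 1 ≤ t := by exact_mod_cast ht
    have h2 := Nat.le_ceil (Real.exp (r / 2)⁻¹)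
    have h3 := Real.exp_pos (r / 2)⁻¹
    nlinarith
  have hs' : ⌈Real.exp (r / 2)⁻¹⌉₊ + 1 ≤ s := hs
  have ht' : ⌈Real.exp (r / 2)⁻¹⌉₊ + 1 ≤ t := ht
  dsimp only
  rw [rate_eq hC0 (by omega), rate_eq hC0 (by omega)]
  refine mul_le_mul_of_nonneg_left ?_ (by positivity)
  refine Real.log_div_self_rpow_antitoneOn (by positivity) (key s hs') (key t ht') ?_
  have : (s : ℝ) ≤ t := by exact_mod_cast hst
  gcongr

theorem rate_tendsto_zero {C r c : ℝ} (hC : 0 < C) (hr : 0 < r) :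
    Tendsto (fun t : ℕ => c * (t : ℝ) ^ (-r) * Real.log (C * (t : ℝ) ^ 2)) atTop (nhds 0) := by
  have h1 : Tendsto (fun t : ℕ => C * (t : ℝ) ^ 2) atTop atTop :=
    ((tendsto_pow_atTop two_ne_zero).comp tendsto_natCast_atTop_atTop).const_mul_atTop hC
  have h2 := ((isLittleO_log_rpow_atTop (half_pos hr)).tendsto_div_nhds_zero.comp h1).const_mul
    (c * C ^ (r / 2))
  rw [mul_zero] at h2
  refine h2.congr' ?_
  filter_upwards [eventually_ge_atTop 1] with t ht
  exact (rate_eq hC ht).symm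

/-- Round 1 always explores, so the average is defined whenever it is played; measurability holds
because round t + 1 uses only the seed and the first t rounds. -/
theorem eoe_isLearningSequence {A B : ℕ} [NeZero A] [NeZero B] {p : ℝ} (hp : 0 < p)
    {Ω : Type*} (u : Ω → unitInterval) (a : ℕ → Ω → Fin A) (b : ℕ → Ω → Fin B)
    (loss : ℕ → Ω → ℝ) :
    IsLearningSequence u a b loss
      (eoeMin (anytimeExp3IX A) (exploreProb p) u a loss)
      (eoeMax (anytimeExp3IX B) (exploreProb p) u b loss) := by
  intro t
  have h : ∀ w, Explores (exploreProb p) (u w) t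
      ∨ 1 ≤ exploreRounds (exploreProb p) (u w) t := fun w => by
    rcases Nat.eq_zero_or_pos t with rfl | ht
    · exact Or.inl (explores_zero p (u w))
    · exact Or.inr (one_le_exploreRounds hp (u w) ht)
  refine ⟨fun w => eoePolicy_mem _ _ t (h w), fun w => eoePolicy_mem _ _ t (h w), ?_, ?_⟩
  · exact @measurable_eoePolicy Ω A _ u a loss (history u a b loss t) (measurable_history_seed t) t
      (fun s hs => measurable_history_min hs) (fun s hs => measurable_history_loss hs)
  · exact @measurable_eoePolicy Ω B _ u b (fun s w => 1 - loss s w) (history u a b loss t)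
      (measurable_history_seed t) t
      (fun s hs => measurable_history_max hs) (fun s hs => (measurable_history_loss hs).const_sub 1)

/-- The numerical bound on the gap of the averages after `n` exploring rounds. -/
theorem regret_sum_div_le {A B n : ℕ} (hA : 1 ≤ A) (hB : 1 ≤ B) (hn : 1 ≤ n) {L y : ℝ}
    (hL : 0 ≤ L) (hy : 0 < y) (hyn : y ≤ 2 * Real.sqrt n) :
    (Real.sqrt n * L * (4.21 * Real.sqrt A + 1) + Real.sqrt n * L * (4.21 * Real.sqrt B + 1)) / n
      ≤ 17 * Real.sqrt (A + B) * L * y⁻¹ := by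
  have hA1 : (1 : ℝ) ≤ A := by exact_mod_cast hA
  have hB1 : (1 : ℝ) ≤ B := by exact_mod_cast hB
  have hn1 : (1 : ℝ) ≤ n := by exact_mod_cast hn
  have hr0 : 0 < Real.sqrt n := Real.sqrt_pos.2 (by linarith)
  have hr2 := Real.sq_sqrt (by linarith : (0 : ℝ) ≤ n)
  have a2 := Real.sq_sqrt (by linarith : (0 : ℝ) ≤ A)
  have b2 := Real.sq_sqrt (by linarith : (0 : ℝ) ≤ B)
  have s2 := Real.sq_sqrt (by linarith : (0 : ℝ) ≤ (A : ℝ) + B)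
  have s0 := Real.sqrt_nonneg ((A : ℝ) + B)
  set r := Real.sqrt n
  set s := Real.sqrt ((A : ℝ) + B)
  -- The factor 1.415 exceeds √2, and 4.21 · 1.415 + 1.415 < 8.5. The loss of 2 between y and √n
  -- doubles this to 17.
  have h1 : Real.sqrt A + Real.sqrt B ≤ 1.415 * s := by
    refine le_of_sq_le_sq ?_ (by positivity)
    nlinarith [sq_nonneg (Real.sqrt A - Real.sqrt B)]
  have h2 : 2 ≤ 1.415 * s := by
    refine le_of_sq_le_sq ?_ (by positivity)
    nlinarith
  have h3 : (r * L * (4.21 * Real.sqrt A + 1) + r * L * (4.21 * Real.sqrt B + 1)) / n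
      = L * (4.21 * (Real.sqrt A + Real.sqrt B) + 2) * r⁻¹ := by
    rw [← hr2]; field_simp; ring
  have h4 : r⁻¹ ≤ 2 * y⁻¹ := by
    rw [← div_eq_mul_inv, inv_eq_one_div, div_le_div_iff₀ hr0 hy]; linarith
  rw [h3]
  calc L * (4.21 * (Real.sqrt A + Real.sqrt B) + 2) * r⁻¹
      ≤ L * (8.5 * s) * (2 * y⁻¹) := by
        refine mul_le_mul (mul_le_mul_of_nonneg_left (by linarith) hL) h4 (by positivity)
          (by positivity)
    _ = 17 * s * L * y⁻¹ := by ring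

/-- Exploring, failing and well-estimated rounds together give the `p`-th moment of the rate. -/
theorem moment_sum_le {p q D : ℝ} (hp : 0 < p) (hq : 0 ≤ q) (hD : Real.exp 1 ≤ D) :
    q + p * q + D ^ p * q ≤ 2 * D ^ p * q := by
  have h1 : 1 + p ≤ D ^ p :=
    calc 1 + p ≤ Real.exp p := by linarith [Real.add_one_le_exp p]
      _ = Real.exp 1 ^ p := by rw [← Real.exp_mul, one_mul]
      _ ≤ D ^ p := Real.rpow_le_rpow (Real.exp_pos _).le hD hp.le
  nlinarith [mul_le_mul_of_nonneg_right h1 hq]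

/-! ### The moment bound in a single round -/

section Final

variable {A B : ℕ} [NeZero A] [NeZero B] {p : ℝ} {G : MatrixGame A B} {Ω : Type*}
  [MeasurableSpace Ω] {P : Measure Ω} [IsProbabilityMeasure P] {u : Ω → unitInterval}
  {a : ℕ → Ω → Fin A} {b : ℕ → Ω → Fin B} {loss : ℕ → Ω → ℝ}

/-- In an exploiting round, the gap is small outside an event whose probability is controlled
through `V`. -/
theorem exists_gap_control (hp : 0 < p)
    (hplay : IsPlay G P u a b loss
      (eoeMin (anytimeExp3IX A) (exploreProb p) u a loss)
      (eoeMax (anytimeExp3IX B) (exploreProb p) u b loss)) (t : ℕ) :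
    ∃ V : Ω → ℝ≥0∞, Measurable V ∧ ∫⁻ w, V w ∂P ≤ ENNReal.ofReal (2 * (A + B)) ∧
      ∀ᵐ w ∂P, ¬Explores (exploreProb p) (u w) t → ∀ L : ℝ, 1 ≤ L → Real.log (A + B) ≤ L →
        V w ≤ ENNReal.ofReal (Real.exp L) →
        G.exploitabilityGap (eoeMin (anytimeExp3IX A) (exploreProb p) u a loss (t + 1) w)
            (eoeMax (anytimeExp3IX B) (exploreProb p) u b loss (t + 1) w)
          ≤ 17 * Real.sqrt (A + B) * L * ((t + 1 : ℕ) : ℝ) ^ (-(1 / (2 + p))) := by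
  have hA : 1 ≤ A := NeZero.pos A
  have hB : 1 ≤ B := NeZero.pos B
  have hl := eoe_isLearningSequence hp u a b loss
  have hu : Measurable[hplay.filtration 0] u := measurable_history_seed 0
  obtain ⟨V, hVm, hV1, hV⟩ := (hplay.feedback_min hl).exists_regret_control hu
    (q := exploreProb p) (fun s w hs => (eoePolicy_succ _ _ _ s).trans (if_pos hs)) t
  obtain ⟨V', hVm', hV1', hV'⟩ := (hplay.feedback_max hl).exists_regret_control hu
    (q := exploreProb p) (fun s w hs => (eoePolicy_succ _ _ _ s).trans (if_pos hs)) t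
  refine ⟨fun w => V w + V' w, hVm.add hVm', ?_, ?_⟩
  · rw [lintegral_add_left hVm]
    have h1 : ((A : ℝ≥0∞) + 1) + (B + 1) = ENNReal.ofReal (A + 1 + (B + 1)) := by
      rw [ENNReal.ofReal_add (by positivity) (by positivity),
        ENNReal.ofReal_add (by positivity) (by positivity),
        ENNReal.ofReal_add (by positivity) (by positivity), ENNReal.ofReal_natCast,
        ENNReal.ofReal_natCast, ENNReal.ofReal_one]
    refine (add_le_add hV1 hV1').trans (h1.le.trans (ENNReal.ofReal_le_ofReal ?_))
    have hA1 : (1 : ℝ) ≤ A := by exact_mod_cast hA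
    have hB1 : (1 : ℝ) ≤ B := by exact_mod_cast hB
    linarith
  filter_upwards [hV, hV'] with w hw hw' ht L hL1 hLAB hVL
  have ht1 : 1 ≤ t := by
    by_contra h0
    obtain rfl : t = 0 := by omega
    exact ht (explores_zero p (u w))
  have hn := one_le_exploreRounds hp (u w) ht1
  have hLA : Real.log A ≤ L := le_trans (Real.log_le_log (by exact_mod_cast hA)
    (le_add_of_nonneg_right (Nat.cast_nonneg B))) hLAB
  have hLB : Real.log B ≤ L := le_trans (Real.log_le_log (by exact_mod_cast hB)
    (le_add_of_nonneg_left (Nat.cast_nonneg A))) hLAB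
  refine (exploitabilityGap_le_regret G (a := fun s => a s w) (b := fun s => b s w)
    (loss := fun s => loss s w)
    (μ := fun s => eoeMin (anytimeExp3IX A) (exploreProb p) u a loss s w)
    (ν := fun s => eoeMax (anytimeExp3IX B) (exploreProb p) u b loss s w) ht hn
    (fun s => rfl) (fun s => rfl)
    (fun i => hw hn i L hL1 hLA ((le_add_right le_rfl).trans hVL))
    (fun j => hw' hn j L hL1 hLB ((le_add_left le_rfl).trans hVL))).trans ?_
  rw [Real.rpow_neg (by positivity)]
  exact regret_sum_div_le hA hB hn (by linarith) (by positivity)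
    (rpow_le_sqrt_exploreRounds hp (u w) ht1)

theorem eLpNorm_gap_le (hp : 0 < p) (hp2 : p ≤ 2) (hmap : P.map u = volume)
    (hplay : IsPlay G P u a b loss
      (eoeMin (anytimeExp3IX A) (exploreProb p) u a loss)
      (eoeMax (anytimeExp3IX B) (exploreProb p) u b loss)) (t : ℕ) {L : ℝ}
    (hL : L = Real.log (4 * (A + B) / p * ((t + 1 : ℕ) : ℝ) ^ 2)) :
    eLpNorm (fun w => G.exploitabilityGap
        (eoeMin (anytimeExp3IX A) (exploreProb p) u a loss (t + 1) w)
        (eoeMax (anytimeExp3IX B) (exploreProb p) u b loss (t + 1) w)) (ENNReal.ofReal p) P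
      ≤ ENNReal.ofReal (17 * Real.sqrt (A + B) * (2 : ℝ) ^ (1 / p)
        * ((t + 1 : ℕ) : ℝ) ^ (-(1 / (2 + p))) * L) := by
  obtain ⟨V, hVm, hV1, hV⟩ := exists_gap_control hp hplay t
  have hl := eoe_isLearningSequence hp u a b loss t
  have hA1 : (1 : ℝ) ≤ A := by exact_mod_cast NeZero.pos A
  have hB1 : (1 : ℝ) ≤ B := by exact_mod_cast NeZero.pos B
  have hT1 : (1 : ℝ) ≤ ((t + 1 : ℕ) : ℝ) := by exact_mod_cast Nat.le_add_left 1 t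
  set T : ℝ := ((t + 1 : ℕ) : ℝ) with hT
  have hT0 : 0 < T := by linarith
  have hT2 : 1 ≤ T ^ 2 := one_le_pow₀ hT1
  set gap := fun w => G.exploitabilityGap
        (eoeMin (anytimeExp3IX A) (exploreProb p) u a loss (t + 1) w)
        (eoeMax (anytimeExp3IX B) (exploreProb p) u b loss (t + 1) w) with hgap
  -- From p ≤ 2. Hence exp L ≥ 2(A + B) ≥ 4 > e, which gives both conditions on L in
  -- `exists_gap_control`.
  have hX : 2 * (A + B) ≤ 4 * (A + B) / p * T ^ 2 := by
    rw [div_mul_eq_mul_div, le_div_iff₀ hp]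
    have : 2 * ((A : ℝ) + B) * p ≤ 4 * (A + B) := by nlinarith
    nlinarith
  have hexpL : Real.exp L = 4 * (A + B) / p * T ^ 2 := by
    rw [hL, Real.exp_log (by positivity)]
  have hLAB : Real.log (A + B) ≤ L := by
    rw [hL]; exact Real.log_le_log (by positivity) (by linarith)
  have hL1 : 1 ≤ L := by
    rw [hL, Real.le_log_iff_exp_le (by positivity)]
    linarith [Real.exp_one_lt_d9]
  set s := Real.sqrt ((A : ℝ) + B) with hs
  have hs1 : 1 ≤ s := Real.one_le_sqrt.2 (by linarith)
  set D := 17 * s * L with hD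
  have hD3 : Real.exp 1 ≤ D := by
    have := Real.exp_one_lt_d9
    nlinarith
  have hD0 : 0 < D := (Real.exp_pos 1).trans_le hD3
  set y := T ^ (-(1 / (2 + p))) with hy
  have hy0 : 0 < y := Real.rpow_pos_of_pos hT0 _
  set q := exploreProb p (t + 1) with hq
  have hq0 : 0 ≤ q := exploreProb_nonneg p _
  have hyp : y ^ p = q := by
    rw [hy, hq, exploreProb, ← Real.rpow_mul hT0.le]
    congr 1; ring
  have hqT : 1 / T ^ 2 ≤ q := by
    have h1 : p / (2 + p) ≤ 2 := by rw [div_le_iff₀ (by positivity)]; linarith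
    calc 1 / T ^ 2 = T ^ (-(2 : ℝ)) := by
          rw [Real.rpow_neg hT0.le, one_div]; norm_num
      _ ≤ q := Real.rpow_le_rpow_of_exponent_le hT1 (by linarith)
  -- Markov's inequality: 2(A + B)/exp L = (p/2) T⁻², and T⁻² ≤ q. This dictates the argument of the
  -- logarithm in the rate.
  have hbad : P {w | ENNReal.ofReal (Real.exp L) ≤ V w} ≤ ENNReal.ofReal (p * q) := by
    have h1 := (mul_meas_ge_le_lintegral₀ (μ := P) hVm.aemeasurable
      (ENNReal.ofReal (Real.exp L))).trans hV1
    rw [mul_comm, ← ENNReal.le_div_iff_mul_le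
      (Or.inl (ENNReal.ofReal_pos.2 (Real.exp_pos L)).ne') (Or.inl ENNReal.ofReal_ne_top),
      ← ENNReal.ofReal_div_of_pos (Real.exp_pos L)] at h1
    refine h1.trans (ENNReal.ofReal_le_ofReal ?_)
    have h2 : 2 * ((A : ℝ) + B) / Real.exp L = p / 2 * (1 / T ^ 2) := by
      rw [hexpL]; field_simp; norm_num
    rw [h2]
    exact mul_le_mul (by linarith) hqT (by positivity) hp.le
  have hexplore : P {w | Explores (exploreProb p) (u w) t} ≤ ENNReal.ofReal q :=
    measure_explores_le hplay.measurable_seed hmap (exploreProb_nonneg p)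
      (exploreProb_le_one hp) (exploreProb_one p) t
  have hgap0 : ∀ w, 0 ≤ gap w := fun w => G.exploitabilityGap_nonneg (hl.1 w) (hl.2.1 w)
  have hgap1 : ∀ w, gap w ≤ 1 := fun w => G.exploitabilityGap_le_one (hl.1 w) (hl.2.1 w)
  have hEm : MeasurableSet {w | Explores (exploreProb p) (u w) t} :=
    measurableSet_explores hplay.measurable_seed t
  have hbm : MeasurableSet {w | ENNReal.ofReal (Real.exp L) ≤ V w} :=
    measurableSet_le measurable_const hVm
  have hmoment : ∫⁻ w, ‖gap w‖ₑ ^ p ∂P ≤ ENNReal.ofReal (2 * D ^ p * q) := by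
    -- The trivial bound 1 is used in exploring rounds and on the bad event; elsewhere the gap is at
    -- most Dy, and y^p = q.
    have hpt : ∀ᵐ w ∂P, ‖gap w‖ₑ ^ p
        ≤ {w | Explores (exploreProb p) (u w) t}.indicator 1 w
          + {w | ENNReal.ofReal (Real.exp L) ≤ V w}.indicator 1 w
          + ENNReal.ofReal (D ^ p * q) := by
      filter_upwards [hV] with w hw
      rw [Real.enorm_eq_ofReal (hgap0 w), ENNReal.ofReal_rpow_of_nonneg (hgap0 w) hp.le]
      have hone : ENNReal.ofReal (gap w ^ p) ≤ 1 := by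
        rw [← ENNReal.ofReal_one]
        exact ENNReal.ofReal_le_ofReal (Real.rpow_le_one (hgap0 w) (hgap1 w) hp.le)
      by_cases h1 : Explores (exploreProb p) (u w) t
      · refine le_add_right (le_add_right ?_)
        rwa [Set.indicator_of_mem (show w ∈ {w | Explores (exploreProb p) (u w) t} from h1)]
      by_cases h2 : ENNReal.ofReal (Real.exp L) ≤ V w
      · refine le_add_right (le_add_left ?_)
        rwa [Set.indicator_of_mem (show w ∈ {w | ENNReal.ofReal (Real.exp L) ≤ V w} from h2)]
      refine le_add_left (ENNReal.ofReal_le_ofReal ?_)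
      rw [← hyp, ← Real.mul_rpow hD0.le hy0.le]
      exact Real.rpow_le_rpow (hgap0 w) (hw h1 L hL1 hLAB (not_le.1 h2).le) hp.le
    refine (lintegral_mono_ae hpt).trans ?_
    rw [lintegral_add_right _ measurable_const,
      lintegral_add_right _ (measurable_one.indicator hbm), lintegral_indicator_one hEm,
      lintegral_indicator_one hbm, lintegral_const, measure_univ, mul_one]
    refine (add_le_add (add_le_add hexplore hbad) le_rfl).trans ?_
    rw [← ENNReal.ofReal_add hq0 (by positivity), ← ENNReal.ofReal_add (by positivity)
      (by positivity)]
    exact ENNReal.ofReal_le_ofReal (moment_sum_le hp hq0 hD3)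
  rw [eLpNorm_eq_lintegral_rpow_enorm_toReal (ENNReal.ofReal_pos.2 hp).ne' ENNReal.ofReal_ne_top,
    ENNReal.toReal_ofReal hp.le, one_div, ENNReal.rpow_inv_le_iff hp,
    ENNReal.ofReal_rpow_of_nonneg (by positivity) hp.le]
  refine hmoment.trans (ENNReal.ofReal_le_ofReal (le_of_eq ?_))
  have h2p : ((2 : ℝ) ^ p⁻¹) ^ p = 2 := Real.rpow_inv_rpow zero_le_two hp.ne'
  have hsplit : 17 * s * (2 : ℝ) ^ p⁻¹ * y * L = (2 : ℝ) ^ p⁻¹ * (D * y) := by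
    rw [hD]; ring
  rw [hsplit, Real.mul_rpow (x := (2 : ℝ) ^ p⁻¹) (by positivity) (by positivity), h2p,
    Real.mul_rpow hD0.le hy0.le, hyp, mul_assoc]

end Final

end BanditGame

theorem theorem2 {A B : ℕ} (hA : 1 ≤ A) (hB : 1 ≤ B) (p : ℝ) (hp : 0 < p) (hp2 : p ≤ 2)
    (G : MatrixGame A B) {Ω : Type*} [MeasurableSpace Ω] (P : Measure Ω) [IsProbabilityMeasure P]
    (u : Ω → unitInterval) (hu : P.map u = volume)
    (a : ℕ → Ω → Fin A) (b : ℕ → Ω → Fin B) (loss : ℕ → Ω → ℝ)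
    (hplay : IsPlay G P u a b loss
      (eoeMin (anytimeExp3IX A) (exploreProb p) u a loss)
      (eoeMax (anytimeExp3IX B) (exploreProb p) u b loss)) :
    LastIterateConvergence G P u a b loss
      (eoeMin (anytimeExp3IX A) (exploreProb p) u a loss)
      (eoeMax (anytimeExp3IX B) (exploreProb p) u b loss)
      p
      (fun t => 17 * Real.sqrt (A + B) * (2 : ℝ) ^ (1 / p) * (t : ℝ) ^ (-(1 / (2 + p)))
        * Real.log (4 * (A + B) * (t : ℝ) ^ 2 / p)) := by
  have : NeZero A := ⟨by omega⟩
  have : NeZero B := ⟨by omega⟩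
  have hA1 : (1 : ℝ) ≤ A := by exact_mod_cast hA
  have hB1 : (1 : ℝ) ≤ B := by exact_mod_cast hB
  have hC : 4 ≤ 4 * ((A : ℝ) + B) / p := by
    rw [le_div_iff₀ hp]; linarith
  have hC0 : 0 < 4 * ((A : ℝ) + B) / p := by linarith
  have hr : 0 < 1 / (2 + p) := by positivity
  have hlog : ∀ t : ℕ, Real.log (4 * (A + B) * (t : ℝ) ^ 2 / p)
      = Real.log (4 * (A + B) / p * (t : ℝ) ^ 2) := fun t => by
    rw [div_mul_eq_mul_div]
  simp only [hlog]
  refine ⟨eoe_isLearningSequence hp u a b loss, fun t ht => ?_,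
    rate_antitoneOn (by linarith) hr (by positivity), rate_tendsto_zero hC0 hr, fun t ht => ?_⟩
  · have ht1 : (1 : ℝ) ≤ t := by exact_mod_cast ht
    have ht2 : 1 ≤ (t : ℝ) ^ 2 := one_le_pow₀ ht1
    have : 0 < Real.log (4 * (A + B) / p * (t : ℝ) ^ 2) := Real.log_pos (by nlinarith)
    positivity
  · obtain ⟨t, rfl⟩ : ∃ s, t = s + 1 := ⟨t - 1, by omega⟩
    exact eLpNorm_gap_le hp hp2 hu hplay t rfl
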